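/- **Setting.** All categories and functors are additive. A *cleft extension* $(\mathcal B,\mathcal A,\mathsf i,\mathsf e,\mathsf l)$ of an abelian category $\mathcal B$ is an abelian category $\mathcal A$ together with functors $\mathsf i\colon\mathcal B\to\mathcal A$, $\mathsf e\colon\mathcal A\to\mathcal B$, $\mathsf l\colon\mathcal B\to\mathcal A$ such that $\mathsf e$ is faithful and exact, $(\mathsf l,\mathsf e)$ is an adjoint pair, and $\mathsf e\mathsf i\simeq\mathrm{Id}_{\mathcal B}$. Let $\mathsf G\colon\mathcal A\to\mathcal A$ be the functor $\mathsf G(X)=\ker(\mu_X)$, where $\mu\colon\mathsf l\mathsf e\to\mathrm{Id}_{\mathcal A}$ is the counit, and let $\mathsf F=\mathsf e\mathsf G\mathsf i\colon\mathcal B\to\mathcal B$. For an abelian category $\mathcal C$ with enough projectives, the *singularity category* of $\mathcal C$ is the Verdier quotient $\mathsf D_{\mathsf{sg}}(\mathcal C)=\mathsf D^{\mathsf b}(\mathcal C)/\mathsf K^{\mathsf b}(\mathrm{Proj}\,\mathcal C)$. **Theorem.** Let $(\mathcal B,\mathcal A,\mathsf i,\mathsf e,\mathsf l)$ be a cleft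 extension of abelian categories with enough projectives. Assume that (a) $\mathrm{pd}_{\mathcal B}\,\mathsf F(P)<\infty$ for every projective object $P$ of $\mathcal B$; (b) the left derived functors satisfy $\mathbb L_n\mathsf F=0$ for all sufficiently large $n$; (c) $\mathsf e$ reflects objects of finite projective dimension: for every $X\in\mathcal A$, if $\mathrm{pd}_{\mathcal B}\,\mathsf e(X)<\infty$ then $\mathrm{pd}_{\mathcal A}\,X<\infty$. Then the functor $\mathsf e\colon\mathsf D^{\mathsf b}(\mathcal A)\to\mathsf D^{\mathsf b}(\mathcal B)$ maps $\mathsf K^{\mathsf b}(\mathrm{Proj}\,\mathcal A)$ into $\mathsf K^{\mathsf b}(\mathrm{Proj}\,\mathcal B)$, and the total left derived functor $\mathbb L\mathsf F\colon\mathsf D^-(\mathcal B)\to\mathsf D^-(\mathcal B)$ maps $\mathsf D^{\mathsf b}(\mathcal B)$ into itself and $\mathsf K^{\mathsf b}(\mathrm{Proj}\,\mathcal B)$ into itself; hence there are induced triangle functors $\mathsf e\colon\mathsf D_{\mathsf{sg}}(\mathcal A)\to\mathsf D_{\mathsf{sg}}(\mathcal B)$ and $\mathbb L_{\mathsf{sg}}\mathsf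 F\colon\mathsf D_{\mathsf{sg}}(\mathcal B)\to\mathsf D_{\mathsf{sg}}(\mathcal B)$. Moreover, the following are equivalent: (i) $\mathsf e\colon\mathsf D_{\mathsf{sg}}(\mathcal A)\to\mathsf D_{\mathsf{sg}}(\mathcal B)$ is a triangle equivalence; (ii) $\mathbb L_{\mathsf{sg}}\mathsf F\simeq 0$ on $\mathsf D_{\mathsf{sg}}(\mathcal B)$. -/

import Mathlib

open CategoryTheory CategoryTheory.Limits CategoryTheory.Pretriangulated

universe w w₁ w₂ v v₁ v₂ u u₁ u₂

namespace SingularityCategory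

section Projectives

variable {C : Type u} [Category.{v} C] [Abelian C]

/-- The property of objects of the homotopy category given by a property of cochain complexes. -/
def onComplex (P : CochainComplex C ℤ → Prop) : ObjectProperty (HomotopyCategory C (.up ℤ)) :=
  fun K => P K.as

lemma onComplex_quotient_iff (P : CochainComplex C ℤ → Prop) (K : CochainComplex C ℤ) :
    onComplex P ((HomotopyCategory.quotient _ _).obj K) ↔ P K := Iff.rfl

lemma onComplex_isTriangulated (P : CochainComplex C ℤ → Prop)
    (hzero : ∀ K : CochainComplex C ℤ, (∀ n, IsZero (K.X n)) → P K)
    (hshift : ∀ (K : CochainComplex C ℤ) (n : ℤ), P K → P (K⟦n⟧))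
    (hcone : ∀ {K L : CochainComplex C ℤ} (f : K ⟶ L), P K → P L →
      P (CochainComplex.mappingCone f)) :
    (onComplex P).IsTriangulated :=
  have h₀ : (onComplex P).ContainsZero :=
    ⟨(HomotopyCategory.quotient _ _).obj (HomologicalComplex.zero),
      Functor.map_isZero _ (HomologicalComplex.isZero_zero),
      (onComplex_quotient_iff P _).2 (hzero _ fun _ => isZero_zero C)⟩
  have h₁ : (onComplex P).IsStableUnderShift ℤ :=
    { isStableUnderShiftBy := fun n => ⟨by
        intro K hK
        obtain ⟨K, rfl⟩ := HomotopyCategory.quotient_obj_surjective K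
        rw [ObjectProperty.prop_shift_iff, HomotopyCategory.shift_quotient_obj,
          onComplex_quotient_iff]
        exact hshift K n hK⟩ }
  have h₃ : (onComplex P).IsTriangulatedClosed₃ := ⟨by
    intro T hT hK hL
    obtain ⟨f : T.obj₁.as ⟶ T.obj₂.as, hf⟩ := (HomotopyCategory.quotient _ _).map_surjective T.mor₁
    refine ⟨(HomotopyCategory.quotient _ _).obj (CochainComplex.mappingCone f),
      hcone f hK hL,
      ⟨Triangle.π₃.mapIso (isoTriangleOfIso₁₂ T _ hT
        (HomotopyCategory.mappingCone_triangleh_distinguished f)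
        (Iso.refl _) (Iso.refl _) ?_)⟩⟩
    rw [← hf]
    exact (Category.comp_id _).trans (Category.id_comp _).symm⟩
  { toContainsZero := h₀
    toIsStableUnderShift := h₁
    toIsTriangulatedClosed₂ := .of_isTriangulatedClosed₃ }

lemma projective_mappingCone_X {K L : CochainComplex C ℤ} (f : K ⟶ L)
    (hK : ∀ n, Projective (K.X n)) (hL : ∀ n, Projective (L.X n)) (n : ℤ) :
    Projective ((CochainComplex.mappingCone f).X n) := by
  have := hK (n + 1)
  have := hL n
  exact Projective.of_iso (HomologicalComplex.homotopyCofiber.XIsoBiprod f n (n + 1) (by simp)).symm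
    inferInstance

lemma isStrictlyLE_mappingCone {K L : CochainComplex C ℤ} (f : K ⟶ L) (n₁ n₂ : ℤ)
    [K.IsStrictlyLE n₁] [L.IsStrictlyLE n₂] :
    (CochainComplex.mappingCone f).IsStrictlyLE (max n₁ n₂) := by
  rw [CochainComplex.isStrictlyLE_iff]
  intro i hi
  rw [CochainComplex.mappingCone.isZero_X_iff]
  exact ⟨K.isZero_of_isStrictlyLE n₁ _ (by have := le_max_left n₁ n₂; omega),
    L.isZero_of_isStrictlyLE n₂ _ (by have := le_max_right n₁ n₂; omega)⟩

/-- A bounded above cochain complex of projective objects. -/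
structure IsProjMinus (K : CochainComplex C ℤ) : Prop where
  projective (n : ℤ) : Projective (K.X n)
  boundedAbove : ∃ b : ℤ, K.IsStrictlyLE b

/-- A bounded cochain complex of projective objects. -/
structure IsProjBounded (K : CochainComplex C ℤ) : Prop extends IsProjMinus K where
  boundedBelow : ∃ a : ℤ, K.IsStrictlyGE a

lemma IsProjMinus.isKProjective {K : CochainComplex C ℤ} (hK : IsProjMinus K) :
    K.IsKProjective := by
  obtain ⟨b, _⟩ := hK.boundedAbove
  have := hK.projective
  exact CochainComplex.isKProjective_of_projective K b

lemma IsProjMinus.shift {K : CochainComplex C ℤ} (hK : IsProjMinus K) (n : ℤ) :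
    IsProjMinus (K⟦n⟧) where
  projective i := hK.projective (i + n)
  boundedAbove := by
    obtain ⟨b, _⟩ := hK.boundedAbove
    exact ⟨b - n, K.isStrictlyLE_shift b n _ (by omega)⟩

lemma IsProjMinus.mappingCone {K L : CochainComplex C ℤ} (f : K ⟶ L) (hK : IsProjMinus K)
    (hL : IsProjMinus L) : IsProjMinus (CochainComplex.mappingCone f) where
  projective := projective_mappingCone_X f hK.projective hL.projective
  boundedAbove := by
    obtain ⟨b, _⟩ := hK.boundedAbove
    obtain ⟨b', _⟩ := hL.boundedAbove
    exact ⟨_, isStrictlyLE_mappingCone f b b'⟩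

lemma isProjBounded_of_isZero (K : CochainComplex C ℤ) (hK : ∀ n, IsZero (K.X n)) :
    IsProjBounded K where
  projective n := (hK n).projective
  boundedAbove := ⟨0, (K.isStrictlyLE_iff 0).2 fun i _ => hK i⟩
  boundedBelow := ⟨0, (K.isStrictlyGE_iff 0).2 fun i _ => hK i⟩

variable (C)

/-- `K⁻(Proj C)`: the homotopy category of bounded above complexes of projective objects. -/
abbrev KMinusProj : Type _ := (onComplex (C := C) IsProjMinus).FullSubcategory

/-- `Kᵇ(Proj C)`: the homotopy category of bounded complexes of projective objects. -/
abbrev KBoundedProj : Type _ := (onComplex (C := C) IsProjBounded).FullSubcategory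

instance : (onComplex (C := C) IsProjMinus).IsTriangulated :=
  onComplex_isTriangulated _ (fun K hK => (isProjBounded_of_isZero K hK).toIsProjMinus)
    (fun _ n hK => hK.shift n) (fun f hK hL => hK.mappingCone f hL)

instance : (onComplex (C := C) IsProjBounded).IsTriangulated :=
  onComplex_isTriangulated _ isProjBounded_of_isZero
    (fun K n hK =>
      { toIsProjMinus := hK.toIsProjMinus.shift n
        boundedBelow := by
          obtain ⟨a, _⟩ := hK.boundedBelow
          exact ⟨a - n, K.isStrictlyGE_shift a n _ (by omega)⟩ })
    (fun {K L} f hK hL =>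
      { toIsProjMinus := hK.toIsProjMinus.mappingCone f hL.toIsProjMinus
        boundedBelow := by
          obtain ⟨a, _⟩ := hK.boundedBelow
          obtain ⟨a', _⟩ := hL.boundedBelow
          exact ⟨min (a - 1) a', CochainComplex.isStrictlyGE_mappingCone f a a' _
            (by have := min_le_left (a - 1) a'; omega) (min_le_right _ _)⟩ })

lemma quasiIso_of_opEquivalence {K L : CochainComplex C ℤ} (f : K ⟶ L)
    (hf : QuasiIso ((CochainComplex.opEquivalence C).functor.map f.op)) : QuasiIso f where
  quasiIsoAt n := by
    obtain ⟨m, rfl⟩ : ∃ m, n = -m := ⟨-n, by simp⟩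
    have h := hf.quasiIsoAt m
    rw [quasiIsoAt_iff' _ (m - 1) m (m + 1) (by simp) (by simp)] at h
    rw [quasiIsoAt_iff' _ (-(m + 1)) (-m) (-(m - 1)) (by simp; omega) (by simp; omega),
      ← ShortComplex.quasiIso_opMap_iff]
    exact h

lemma exists_quasiIso_projective [EnoughProjectives C] (K : CochainComplex C ℤ) (b : ℤ)
    [K.IsStrictlyLE b] :
    ∃ (P : CochainComplex C ℤ) (f : P ⟶ K), IsProjMinus P ∧ QuasiIso f := by
  let E := CochainComplex.opEquivalence C
  have : (E.functor.obj (Opposite.op K)).IsStrictlyGE (-b) := by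
    rw [CochainComplex.isStrictlyGE_iff]
    intro i hi
    exact (K.isZero_of_isStrictlyLE b (-i) (by omega)).op
  obtain ⟨L, i, hi, hL, hL'⟩ :=
    CochainComplex.Plus.modelCategoryQuillen.exists_quasiIso_injective
      (E.functor.obj (Opposite.op K)) (-b)
  let j : Opposite.op K ⟶ E.inverse.obj L := E.toAdjunction.homEquiv _ _ i
  have hj : E.functor.map j ≫ E.counit.app L = i := by
    have := (E.toAdjunction.homEquiv (Opposite.op K) L).symm_apply_apply i
    rw [Adjunction.homEquiv_counit] at this
    exact this
  refine ⟨(E.inverse.obj L).unop, j.unop, ⟨fun n => ?_, b, ?_⟩, ?_⟩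
  · have := hL (-n)
    exact (inferInstance : Projective (Opposite.unop (L.X (-n))))
  · rw [CochainComplex.isStrictlyLE_iff]
    intro n hn
    exact (L.isZero_of_isStrictlyGE (-b) (-n) (by omega)).unop
  · apply quasiIso_of_opEquivalence
    have : QuasiIso (E.functor.map j ≫ E.counit.app L) := by rw [hj]; exact hi
    exact quasiIso_of_comp_right (E.functor.map j) (E.counit.app L)

end Projectives

section Resolutions

open DerivedCategory DerivedCategory.TStructure

variable (C : Type u) [Category.{v} C] [Abelian C] [HasDerivedCategory.{w} C]

/-- The canonical functor `K⁻(Proj C) ⥤ D⁻(C)`. -/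
noncomputable def KMinusProj.toMinus : KMinusProj C ⥤ DerivedCategory.Minus C :=
  t.minus.lift (ObjectProperty.ι _ ⋙ DerivedCategory.Qh) (by
    rintro ⟨K, hK⟩
    obtain ⟨K : CochainComplex C ℤ, rfl⟩ := HomotopyCategory.quotient_obj_surjective K
    obtain ⟨b, hb⟩ := hK.boundedAbove
    have : CochainComplex.IsStrictlyLE K b := hb
    exact ⟨b, t.isLE_of_iso (X := Q.obj K) ((quotientCompQhIso C).symm.app K) b⟩)

/-- The canonical functor `Kᵇ(Proj C) ⥤ Dᵇ(C)`. -/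
noncomputable def KBoundedProj.toBounded : KBoundedProj C ⥤ DerivedCategory.Bounded C :=
  t.bounded.lift (ObjectProperty.ι _ ⋙ DerivedCategory.Qh) (by
    rintro ⟨K, hK⟩
    obtain ⟨K : CochainComplex C ℤ, rfl⟩ := HomotopyCategory.quotient_obj_surjective K
    obtain ⟨b, hb⟩ := hK.boundedAbove
    obtain ⟨a, ha⟩ := hK.boundedBelow
    have : CochainComplex.IsStrictlyLE K b := hb
    have : CochainComplex.IsStrictlyGE K a := ha
    exact ⟨⟨a, t.isGE_of_iso (X := Q.obj K) ((quotientCompQhIso C).symm.app K) a⟩,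
      ⟨b, t.isLE_of_iso (X := Q.obj K) ((quotientCompQhIso C).symm.app K) b⟩⟩)

noncomputable instance : (KMinusProj.toMinus C).CommShift ℤ := by
  dsimp only [KMinusProj.toMinus]
  infer_instance

noncomputable instance : (KBoundedProj.toBounded C).CommShift ℤ := by
  dsimp only [KBoundedProj.toBounded]
  infer_instance

instance : (KMinusProj.toMinus C).IsTriangulated := by
  unfold KMinusProj.toMinus; infer_instance

instance : (KBoundedProj.toBounded C).IsTriangulated := by
  unfold KBoundedProj.toBounded; infer_instance

lemma KMinusProj.toMinus_map_bijective (K L : KMinusProj C) :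
    Function.Bijective ((KMinusProj.toMinus C).map : (K ⟶ L) → _) := by
  have := K.property.isKProjective
  have h := CochainComplex.IsKProjective.Qh_map_bijective K.obj.as L.obj
  have h' := h.comp ((ObjectProperty.fullyFaithfulι _).map_bijective K L)
  rw [← Function.Bijective.of_comp_iff' (t.minus.fullyFaithfulι.map_bijective _ _)]
  exact h'

lemma KBoundedProj.toBounded_map_bijective (K L : KBoundedProj C) :
    Function.Bijective ((KBoundedProj.toBounded C).map : (K ⟶ L) → _) := by
  have := K.property.isKProjective
  have h := CochainComplex.IsKProjective.Qh_map_bijective K.obj.as L.obj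
  have h' := h.comp ((ObjectProperty.fullyFaithfulι _).map_bijective K L)
  rw [← Function.Bijective.of_comp_iff' (t.bounded.fullyFaithfulι.map_bijective _ _)]
  exact h'

instance : (KMinusProj.toMinus C).Full := ⟨fun {K L} => (KMinusProj.toMinus_map_bijective C K L).2⟩
instance : (KMinusProj.toMinus C).Faithful :=
  ⟨fun {K L} _ _ h => (KMinusProj.toMinus_map_bijective C K L).1 h⟩
instance : (KBoundedProj.toBounded C).Full :=
  ⟨fun {K L} => (KBoundedProj.toBounded_map_bijective C K L).2⟩

instance [EnoughProjectives C] : (KMinusProj.toMinus C).EssSurj where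
  mem_essImage := by
    rintro ⟨X, n, K, e, hK⟩
    obtain ⟨P, f, hP, hf⟩ := exists_quasiIso_projective C K n
    exact ⟨⟨(HomotopyCategory.quotient C (.up ℤ)).obj P, hP⟩,
      ⟨t.minus.fullyFaithfulι.preimageIso ((quotientCompQhIso C).app P ≪≫
        asIso (Q.map f) ≪≫ e.symm)⟩⟩

instance [EnoughProjectives C] : (KMinusProj.toMinus C).IsEquivalence where

end Resolutions

section Dsg

open DerivedCategory DerivedCategory.TStructure

variable (C : Type u) [Category.{v} C] [Abelian C] [HasDerivedCategory.{w} C]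

/-- The objects of `Dᵇ(C)` that lie in (the essential image of) `Kᵇ(Proj C)`. -/
noncomputable abbrev perfect : ObjectProperty (DerivedCategory.Bounded C) :=
  (KBoundedProj.toBounded C).essImage

/-- The singularity category of `C`: the Verdier quotient `Dᵇ(C) / Kᵇ(Proj C)`. -/
abbrev Dsg : Type _ := (perfect C).trW.Localization

/-- The quotient functor `Dᵇ(C) ⥤ D_sg(C)`. -/
noncomputable abbrev Dsg.Q : DerivedCategory.Bounded C ⥤ Dsg C := (perfect C).trW.Q

variable {C} {D : Type u₁} [Category.{v₁} D] [Abelian D] [HasDerivedCategory.{w₁} D]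

/-- The functor `Φ` maps (the essential image of) `Kᵇ(Proj C)` to that of `Kᵇ(Proj D)`. -/
def PreservesPerfect (Φ : DerivedCategory.Bounded C ⥤ DerivedCategory.Bounded D) : Prop :=
  ∀ X : DerivedCategory.Bounded C, perfect C X → perfect D (Φ.obj X)

lemma inverts_of_preservesPerfect
    (Φ : DerivedCategory.Bounded C ⥤ DerivedCategory.Bounded D) [Φ.CommShift ℤ]
    [Φ.IsTriangulated] (h : PreservesPerfect Φ) :
    (perfect C).trW.IsInvertedBy (Φ ⋙ Dsg.Q D) := by
  rintro X Y f ⟨Z, g, k, hT, hZ⟩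
  exact Localization.inverts (Dsg.Q D) (perfect D).trW _
    ⟨_, _, _, Φ.map_distinguished _ hT, h _ hZ⟩

variable (Φ : DerivedCategory.Bounded C ⥤ DerivedCategory.Bounded D) [Φ.CommShift ℤ]
  [Φ.IsTriangulated] (h : PreservesPerfect Φ)

/-- The functor `D_sg(C) ⥤ D_sg(D)` induced by a triangle functor `Dᵇ(C) ⥤ Dᵇ(D)` which maps
`Kᵇ(Proj C)` to `Kᵇ(Proj D)`. -/
noncomputable def singFunctor : Dsg C ⥤ Dsg D :=
  Localization.lift (Φ ⋙ Dsg.Q D) (inverts_of_preservesPerfect Φ h) (Dsg.Q C)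

noncomputable instance : Localization.Lifting (Dsg.Q C) (perfect C).trW (Φ ⋙ Dsg.Q D)
    (singFunctor Φ h) :=
  ⟨Localization.fac (Φ ⋙ Dsg.Q D) (inverts_of_preservesPerfect Φ h) (Dsg.Q C)⟩

/-- The canonical isomorphism which says that `singFunctor Φ h` is induced by `Φ`. -/
noncomputable def singFunctorFactors : Dsg.Q C ⋙ singFunctor Φ h ≅ Φ ⋙ Dsg.Q D :=
  Localization.Lifting.iso (Dsg.Q C) (perfect C).trW (Φ ⋙ Dsg.Q D) (singFunctor Φ h)

noncomputable instance : (singFunctor Φ h).CommShift ℤ :=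
  Functor.commShiftOfLocalization (Dsg.Q C) (perfect C).trW ℤ (Φ ⋙ Dsg.Q D) (singFunctor Φ h)

instance : NatTrans.CommShift (singFunctorFactors Φ h).hom ℤ :=
  inferInstanceAs (NatTrans.CommShift (Localization.Lifting.iso (Dsg.Q C) (perfect C).trW
    (Φ ⋙ Dsg.Q D) (singFunctor Φ h)).hom ℤ)

instance : (singFunctor Φ h).IsTriangulated :=
  have : (Dsg.Q C).mapArrow.EssSurj := Localization.essSurj_mapArrow _ (perfect C).trW
  Functor.isTriangulated_of_precomp_iso (singFunctorFactors Φ h)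

/-- A triangle equivalence between singularity categories. -/
def IsTriangleEquivalence (Ψ : Dsg C ⥤ Dsg D) [Ψ.CommShift ℤ] : Prop :=
  Ψ.IsTriangulated ∧ Ψ.IsEquivalence

end Dsg

section Derived

open DerivedCategory DerivedCategory.TStructure

variable {C : Type u₁} [Category.{v₁} C] [Abelian C] [HasDerivedCategory.{w₁} C]
  {D : Type u₂} [Category.{v₂} D] [Abelian D] [HasDerivedCategory.{w₂} D]

/-- The functor `Dᵇ(C) ⥤ Dᵇ(D)` induced by an exact functor. -/
noncomputable def mapBounded (F : C ⥤ D) [F.Additive] [PreservesFiniteLimits F]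
    [PreservesFiniteColimits F] : DerivedCategory.Bounded C ⥤ DerivedCategory.Bounded D :=
  t.bounded.lift (Bounded.ι ⋙ F.mapDerivedCategory) (by
    rintro ⟨X, ⟨a, ha⟩, ⟨b, hb⟩⟩
    obtain ⟨K, _, _, ⟨e⟩⟩ := exists_iso_Q_obj_of_isGE_of_isLE X a b
    let e' : Q.obj ((F.mapHomologicalComplex (.up ℤ)).obj K) ≅ F.mapDerivedCategory.obj X :=
      (F.mapDerivedCategoryFactors.app K).symm ≪≫ F.mapDerivedCategory.mapIso e.symm
    exact ⟨⟨a, t.isGE_of_iso e' a⟩, ⟨b, t.isLE_of_iso e' b⟩⟩)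

noncomputable instance (F : C ⥤ D) [F.Additive] [PreservesFiniteLimits F]
    [PreservesFiniteColimits F] : (mapBounded F).CommShift ℤ := by
  dsimp only [mapBounded]
  infer_instance

instance (F : C ⥤ D) [F.Additive] [PreservesFiniteLimits F]
    [PreservesFiniteColimits F] : (mapBounded F).IsTriangulated := by
  unfold mapBounded; infer_instance

variable (F : C ⥤ D) [F.Additive]

/-- The functor `K⁻(Proj C) ⥤ D⁻(D)` which applies `F` termwise. -/
noncomputable def mapKMinusProj : KMinusProj C ⥤ DerivedCategory.Minus D :=
  t.minus.lift (ObjectProperty.ι _ ⋙ F.mapHomotopyCategory (.up ℤ) ⋙ DerivedCategory.Qh) (by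
    rintro ⟨K, hK⟩
    obtain ⟨K : CochainComplex C ℤ, rfl⟩ := HomotopyCategory.quotient_obj_surjective K
    obtain ⟨b, hb⟩ := hK.boundedAbove
    have : CochainComplex.IsStrictlyLE K b := hb
    exact ⟨b, t.isLE_of_iso (X := Q.obj ((F.mapHomologicalComplex (.up ℤ)).obj K))
      ((quotientCompQhIso D).symm.app _) b⟩)

noncomputable instance : (mapKMinusProj F).CommShift ℤ := by
  dsimp only [mapKMinusProj]
  infer_instance

instance : (mapKMinusProj F).IsTriangulated := by
  unfold mapKMinusProj; infer_instance

variable (C) in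
/-- The equivalence `K⁻(Proj C) ≌ D⁻(C)`, whose inverse chooses projective resolutions. -/
noncomputable def projEquivalence [EnoughProjectives C] :
    KMinusProj C ≌ DerivedCategory.Minus C :=
  (KMinusProj.toMinus C).asEquivalence

noncomputable instance [EnoughProjectives C] : (projEquivalence C).functor.CommShift ℤ :=
  inferInstanceAs ((KMinusProj.toMinus C).CommShift ℤ)

instance [EnoughProjectives C] : (projEquivalence C).functor.IsTriangulated :=
  inferInstanceAs ((KMinusProj.toMinus C).IsTriangulated)

noncomputable instance [EnoughProjectives C] : (projEquivalence C).inverse.CommShift ℤ :=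
  (projEquivalence C).commShiftInverse ℤ

instance [EnoughProjectives C] : (projEquivalence C).CommShift ℤ :=
  (projEquivalence C).commShift_of_functor ℤ

instance [EnoughProjectives C] : (projEquivalence C).IsTriangulated :=
  Equivalence.IsTriangulated.mk' _ inferInstance

/-- The total left derived functor `𝕃F : D⁻(C) ⥤ D⁻(D)`, computed by applying `F` to
projective resolutions. -/
noncomputable def leftDerivedMinus [EnoughProjectives C] :
    DerivedCategory.Minus C ⥤ DerivedCategory.Minus D :=
  (projEquivalence C).inverse ⋙ mapKMinusProj F

noncomputable instance [EnoughProjectives C] : (leftDerivedMinus F).CommShift ℤ := by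
  dsimp only [leftDerivedMinus]
  infer_instance

instance [EnoughProjectives C] : (leftDerivedMinus F).IsTriangulated := by
  unfold leftDerivedMinus; infer_instance

variable (C) in
/-- The inclusion `Dᵇ(C) ⥤ D⁻(C)`. -/
noncomputable def boundedToMinus : DerivedCategory.Bounded C ⥤ DerivedCategory.Minus C :=
  t.minus.lift Bounded.ι (fun X => X.property.2)

noncomputable instance : (boundedToMinus C).CommShift ℤ := by
  dsimp only [boundedToMinus]
  infer_instance

instance : (boundedToMinus C).IsTriangulated := by
  unfold boundedToMinus; infer_instance

/-- The total left derived functor `𝕃F : D⁻(C) ⥤ D⁻(D)` maps `Dᵇ(C)` into `Dᵇ(D)`. -/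
def PreservesBounded [EnoughProjectives C] : Prop :=
  ∀ X : DerivedCategory.Bounded C,
    t.bounded ((leftDerivedMinus F).obj ((boundedToMinus C).obj X)).obj

/-- The restriction `𝕃F : Dᵇ(C) ⥤ Dᵇ(D)` of the total left derived functor, when `𝕃F` maps
`Dᵇ(C)` into `Dᵇ(D)`. -/
noncomputable def leftDerivedBounded [EnoughProjectives C] (hF : PreservesBounded F) :
    DerivedCategory.Bounded C ⥤ DerivedCategory.Bounded D :=
  t.bounded.lift (boundedToMinus C ⋙ leftDerivedMinus F ⋙ Minus.ι) (fun X => hF X)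

noncomputable instance [EnoughProjectives C] (hF : PreservesBounded F) :
    (leftDerivedBounded F hF).CommShift ℤ := by
  dsimp only [leftDerivedBounded]
  infer_instance

instance [EnoughProjectives C] (hF : PreservesBounded F) :
    (leftDerivedBounded F hF).IsTriangulated := by
  unfold leftDerivedBounded; infer_instance

end Derived

end SingularityCategory

/-- A cleft extension `(B, A, i, e, l)` of the abelian category `B`: an abelian category `A` with
additive functors `i : B ⥤ A`, `e : A ⥤ B`, `l : B ⥤ A` such that `e` is faithful and exact,
`l` is left adjoint to `e`, and `e i ≅ 𝟭 B`. -/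
structure CleftExtension (B : Type u₁) [Category.{v₁} B] [Abelian B]
    (A : Type u₂) [Category.{v₂} A] [Abelian A] where
  i : B ⥤ A
  e : A ⥤ B
  l : B ⥤ A
  [i_additive : i.Additive]
  [e_additive : e.Additive]
  [l_additive : l.Additive]
  [e_faithful : e.Faithful]
  [e_preservesFiniteLimits : PreservesFiniteLimits e]
  [e_preservesFiniteColimits : PreservesFiniteColimits e]
  adj : l ⊣ e
  eiIso : i ⋙ e ≅ 𝟭 B

namespace CleftExtension

attribute [instance] i_additive e_additive l_additive e_faithful e_preservesFiniteLimits
  e_preservesFiniteColimits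

variable {B : Type u₁} [Category.{v₁} B] [Abelian B] {A : Type u₂} [Category.{v₂} A] [Abelian A]
  (S : CleftExtension B A)

/-- The endofunctor `G` of `A`, with `G X` the kernel of the counit `l (e X) ⟶ X`. -/
noncomputable def G : A ⥤ A where
  obj X := kernel (S.adj.counit.app X)
  map {X Y} f := kernel.map (S.adj.counit.app X) (S.adj.counit.app Y) (S.l.map (S.e.map f)) f
    (S.adj.counit.naturality f).symm

/-- The inclusion `G X ⟶ l (e X)`. -/
noncomputable def Gι (X : A) : S.G.obj X ⟶ S.l.obj (S.e.obj X) := kernel.ι (S.adj.counit.app X)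

instance (X : A) : Mono (S.Gι X) := inferInstanceAs (Mono (kernel.ι (S.adj.counit.app X)))

lemma G_map_Gι {X Y : A} (f : X ⟶ Y) :
    S.G.map f ≫ S.Gι Y = S.Gι X ≫ S.l.map (S.e.map f) :=
  kernel.lift_ι _ _ _

instance : S.G.Additive where
  map_add {X Y f g} := by
    rw [← cancel_mono (S.Gι Y), Preadditive.add_comp, G_map_Gι, G_map_Gι, G_map_Gι,
      S.e.map_add, S.l.map_add, Preadditive.comp_add]

/-- The endofunctor `F = e G i` of `B`. -/
noncomputable def F : B ⥤ B := S.i ⋙ S.G ⋙ S.e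

instance : S.F.Additive := by unfold F; infer_instance

end CleftExtension

namespace SingularityCategory

/-! Since `e i ≅ 𝟭`, the unit `X ⟶ e l X` has a natural retraction, with kernel `F X`. Reading the
resulting natural splitting backwards gives exact sequences `0 ⟶ X ⟶ e l X ⟶ F X ⟶ 0`. Applied
termwise to a projective resolution of `X`, they give a triangle `X ⟶ e 𝕃l X ⟶ 𝕃F X ⟶ X⟦1⟧`. As `e`
is faithful and exact, boundedness of `𝕃F` forces boundedness of `𝕃l`, so there is an adjunction `𝕃l
⊣ e` between the bounded derived categories, and the cone of its unit at `X` is `𝕃F X`.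

Both adjoints preserve perfect objects: `l` preserves projectives, and a projective `P` of `A` is a
retract of some `l Q`, where `e l Q` is an extension of `F Q` by `Q` and so has finite projective
dimension by (a). The adjunction therefore descends to singularity categories. Hypothesis (c) makes
the induced `e` reflect zero objects, hence isomorphisms. A conservative right adjoint is an
equivalence exactly when the unit is invertible, and here that means that `𝕃F X` is perfect for
every `X`.

Perfect objects are detected by `finiteProjDim`, the vanishing of all morphisms to objects of `C` in
very negative degrees. This condition makes sense on the whole of `D(C)`, is visibly closed under
cones and retracts, and on a single object means finite projective dimension. Closure under retracts
ensures that only perfect objects die in the Verdier quotient. -/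

lemma projectiveDimension_lt_top_iff_exists {C : Type u} [Category.{v} C] [Abelian C] (X : C) :
    projectiveDimension X < ⊤ ↔ ∃ n, HasProjectiveDimensionLT X n := by
  rw [lt_top_iff_ne_top, projectiveDimension_ne_top_iff]
  exact ⟨fun ⟨n, hn⟩ => ⟨n + 1, hn⟩, fun ⟨n, hn⟩ => ⟨n, hasProjectiveDimensionLT_of_ge X n _ n.le_succ⟩⟩

/-- The canonical truncation replaces the term in degree `n` by `K.opcycles n` and keeps the terms
above it, so this is the only new term to control. -/
lemma IsProjMinus.truncGE {C : Type u} [Category.{v} C] [Abelian C]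
    {K : CochainComplex C ℤ} (hK : IsProjMinus K) (n : ℤ)
    (hn : Projective (K.opcycles n)) : IsProjBounded (K.truncGE n) where
  projective i := by
    obtain hi | rfl | hi := lt_trichotomy i n
    · exact ((K.truncGE n).isZero_of_isStrictlyGE n i).projective
    · exact Projective.of_iso (K.truncGEXIsoOpcycles i).symm inferInstance
    · have := hK.projective i
      exact Projective.of_iso (K.truncGEXIso n i).symm inferInstance
  boundedAbove := by
    obtain ⟨b, _⟩ := hK.boundedAbove
    exact ⟨b, inferInstance⟩
  boundedBelow := ⟨n, inferInstance⟩

/-! ### Perfect objects and finite projective dimension -/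

section FiniteProjectiveDimension

open ZeroObject DerivedCategory DerivedCategory.TStructure

variable (C : Type u) [Category.{v} C] [Abelian C] [HasDerivedCategory.{w} C]

/-- The objects of `D(C)` which have no nonzero morphisms to the objects of `C` placed in
sufficiently negative degrees. -/
def finiteProjDim : ObjectProperty (DerivedCategory C) :=
  fun X => ∃ a : ℤ, ∀ n ≤ a, ∀ (M : C) (f : X ⟶ (singleFunctor C n).obj M), f = 0

instance : (finiteProjDim C).IsStableUnderRetracts where
  of_retract {X Y} h := by
    rintro ⟨a, ha⟩
    refine ⟨a, fun n hn M f => ?_⟩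
    rw [← Category.id_comp f, ← h.retract, Category.assoc, ha n hn M (h.r ≫ f), comp_zero]

instance : (finiteProjDim C).IsStableUnderShift ℤ where
  isStableUnderShiftBy k := ⟨by
    rintro X ⟨a, ha⟩
    refine ⟨a - k, fun n hn M f => ?_⟩
    let e := ((singleFunctors C).shiftIso k n (k + n) rfl).app M
    obtain ⟨g, hg⟩ := (shiftFunctor (DerivedCategory C) k).map_surjective (f ≫ e.inv)
    rw [← cancel_mono e.inv, ← hg, ha (k + n) (by omega) M g, Functor.map_zero, zero_comp]⟩

instance : (finiteProjDim C).IsTriangulated where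
  exists_zero := ⟨0, isZero_zero _, 0, fun _ _ _ _ => (isZero_zero _).eq_of_src _ _⟩
  toIsTriangulatedClosed₂ := .mk' (by
    rintro T hT ⟨a, ha⟩ ⟨b, hb⟩
    refine ⟨min a b, fun n hn M f => ?_⟩
    obtain ⟨g, hg⟩ := Triangle.yoneda_exact₂ T hT f
      (ha n (hn.trans (min_le_left _ _)) M _)
    rw [hg, hb n (hn.trans (min_le_right _ _)) M g, comp_zero])

variable {C}

/-- After shifting `X` to degree 0, morphisms to `M` placed in degree `-i` are the elements of
`Ext^i(X, M)`. -/
lemma finiteProjDim_singleFunctor_iff (X : C) (k : ℤ) :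
    finiteProjDim C ((singleFunctor C k).obj X) ↔ projectiveDimension X < ⊤ := by
  have := hasExt_of_hasDerivedCategory C
  let e₀ : ((singleFunctor C k).obj X)⟦k⟧ ≅ (singleFunctor C 0).obj X :=
    ((singleFunctors C).shiftIso k 0 k (by simp)).app X
  rw [← (finiteProjDim C).prop_shift_iff_of_isStableUnderShift _ k,
    (finiteProjDim C).prop_iff_of_iso e₀, projectiveDimension_lt_top_iff_exists]
  let e (Y : C) (i : ℕ) : ((singleFunctor C 0).obj Y)⟦(i : ℤ)⟧ ≅ (singleFunctor C (-i)).obj Y :=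
    ((singleFunctors C).shiftIso i (-i) 0 (by simp)).app Y
  constructor
  · rintro ⟨a, ha⟩
    refine ⟨(-a).toNat, HasProjectiveDimensionLT.mk fun i hi Y x => ?_⟩
    apply Abelian.Ext.ext
    have : x.hom ≫ (e Y i).hom = 0 := ha (-i) (by omega) Y _
    rw [Abelian.Ext.zero_hom, ← cancel_mono (e Y i).hom, this, zero_comp]
  · rintro ⟨n, hn⟩
    refine ⟨-n, fun m hm M f => ?_⟩
    obtain ⟨i, rfl⟩ : ∃ i : ℕ, m = -i := ⟨(-m).toNat, by omega⟩
    obtain ⟨x, hx⟩ := Abelian.Ext.homEquiv.surjective (f ≫ (e M i).inv)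
    rw [← cancel_mono (e M i).inv, ← hx, x.eq_zero_of_hasProjectiveDimensionLT n (by omega)]
    exact (Abelian.Ext.zero_hom _ _ _).trans zero_comp.symm

/-- A cochain complex in degrees `≥ a` is an extension of its term in degree `a` by a complex
in degrees `> a` with the same other terms. -/
lemma exists_distinguished_of_isStrictlyGE (K : CochainComplex C ℤ) (a b : ℤ)
    [K.IsStrictlyGE a] [K.IsStrictlyLE b] :
    ∃ (L : CochainComplex C ℤ) (f : L ⟶ K),
      L.IsStrictlyGE (a + 1) ∧ L.IsStrictlyLE b ∧ (∀ i, a < i → IsIso (f.f i)) ∧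
      ∃ (g : Q.obj K ⟶ (singleFunctor C a).obj (K.X a)) (h : _),
        Triangle.mk (Q.map f) g h ∈ distTriang (DerivedCategory C) := by
  -- The leftmost term of `K` is a quotient complex; the kernel of this projection is the stupid
  -- truncation in degrees `> a`.
  let φ : K ⟶ (HomologicalComplex.single C (.up ℤ) a).obj (K.X a) :=
    HomologicalComplex.mkHomToSingle (𝟙 _)
      (fun i (hi : i + 1 = a) => (K.isZero_of_isStrictlyGE a i (by omega)).eq_of_src _ _)
  have h₀ (i : ℤ) (hi : i ≠ a) :
      IsZero (((HomologicalComplex.single C (.up ℤ) a).obj (K.X a)).X i) :=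
    HomologicalComplex.isZero_single_obj_X _ _ _ _ hi
  have hφ : IsIso (φ.f a) := by
    have : φ.f a = 𝟙 _ ≫ _ := HomologicalComplex.mkHomToSingle_f _ _
    rw [this]
    infer_instance
  have : Epi φ := by
    have (i : ℤ) : Epi (φ.f i) := by
      by_cases hi : i = a
      · subst hi; infer_instance
      · exact ⟨fun _ _ _ => (h₀ i hi).eq_of_src _ _⟩
    exact HomologicalComplex.epi_of_epi_f _ this
  let S : ShortComplex (CochainComplex C ℤ) := .mk _ _ (kernel.condition φ)
  have hS : S.ShortExact := { exact := S.exact_of_f_is_kernel (kernelIsKernel φ) }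
  have hSi (i : ℤ) := hS.map_of_exact (HomologicalComplex.eval C (.up ℤ) i)
  have hm (i : ℤ) : Mono ((kernel.ι φ).f i) := (hSi i).mono_f
  have hiso (i : ℤ) (hi : i ≠ a) : IsIso ((kernel.ι φ).f i) :=
    (hSi i).isIso_f_iff.2 (h₀ i hi)
  refine ⟨_, kernel.ι φ, ?_, ?_, fun i hi => hiso i (by omega), _, _,
    triangleOfSES_distinguished hS⟩
  · rw [CochainComplex.isStrictlyGE_iff]
    intro i hi
    by_cases hi' : i = a
    · subst hi'
      exact (hSi i).isIso_g_iff.1 hφ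
    · exact IsZero.of_mono ((kernel.ι φ).f i) (K.isZero_of_isStrictlyGE a i (by omega))
  · rw [CochainComplex.isStrictlyLE_iff]
    intro i hi
    exact IsZero.of_mono ((kernel.ι φ).f i) (K.isZero_of_isStrictlyLE b i hi)

/-- Dévissage: induction on the length of the complex, splitting off its leftmost term at each step.
-/
lemma prop_Q_obj_of_prop_singleFunctor (P : ObjectProperty (DerivedCategory C))
    [P.IsTriangulated] [P.IsClosedUnderIsomorphisms] (K : CochainComplex C ℤ) (a b : ℤ)
    [K.IsStrictlyGE a] [K.IsStrictlyLE b]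
    (hK : ∀ i, P ((singleFunctor C i).obj (K.X i))) : P (Q.obj K) := by
  obtain ⟨n, hn⟩ : ∃ n : ℕ, b < a + n := ⟨(b - a + 1).toNat, by omega⟩
  induction n generalizing K a with
  | zero =>
    refine P.prop_of_isZero (Q.map_isZero ((IsZero.iff_id_eq_zero _).2 ?_))
    ext i
    by_cases hi : i < a
    · exact (K.isZero_of_isStrictlyGE a i hi).eq_of_src _ _
    · exact (K.isZero_of_isStrictlyLE b i (by omega)).eq_of_src _ _
  | succ n ih =>
    obtain ⟨L, f, _, _, hf, g, h, hT⟩ := exists_distinguished_of_isStrictlyGE K a b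
    refine P.ext_of_isTriangulatedClosed₂ _ hT
      (ih L (a + 1) (fun i => ?_) (by push_cast at hn; omega)) (hK a)
    by_cases hi : a < i
    · have := hf i hi
      exact P.prop_of_iso ((singleFunctor C i).mapIso (asIso (f.f i)).symm) (hK i)
    · exact P.prop_of_isZero ((singleFunctor C i).map_isZero
        (L.isZero_of_isStrictlyGE (a + 1) i (by omega)))

/-- If all but the leftmost term of a bounded complex satisfy a triangulated property, then
the complex satisfies it only if the leftmost term does. -/
lemma prop_singleFunctor_of_prop_Q_obj (P : ObjectProperty (DerivedCategory C))
    [P.IsTriangulated] [P.IsClosedUnderIsomorphisms] (K : CochainComplex C ℤ) (a b : ℤ)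
    [K.IsStrictlyGE a] [K.IsStrictlyLE b] (hP : P (Q.obj K))
    (hK : ∀ i, a < i → P ((singleFunctor C i).obj (K.X i))) :
    P ((singleFunctor C a).obj (K.X a)) := by
  obtain ⟨L, f, _, _, hf, g, h, hT⟩ := exists_distinguished_of_isStrictlyGE K a b
  refine P.ext_of_isTriangulatedClosed₃ _ hT
    (prop_Q_obj_of_prop_singleFunctor P L (a + 1) b fun i => ?_) hP
  by_cases hi : a < i
  · have := hf i hi
    exact P.prop_of_iso ((singleFunctor C i).mapIso (asIso (f.f i)).symm) (hK i hi)
  · exact P.prop_of_isZero ((singleFunctor C i).map_isZero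
      (L.isZero_of_isStrictlyGE (a + 1) i (by omega)))

lemma eq_zero_of_isKProjective {K L : CochainComplex C ℤ} [K.IsKProjective]
    (h : ∀ f : K ⟶ L, f = 0) (f : Q.obj K ⟶ Q.obj L) : f = 0 := by
  obtain ⟨f, rfl⟩ := (CochainComplex.IsKProjective.Qh_map_bijective K
    ((HomotopyCategory.quotient _ _).obj L)).2 f
  obtain ⟨f, rfl⟩ := (HomotopyCategory.quotient _ _).map_surjective f
  rw [h f, Functor.map_zero]
  exact Functor.map_zero _ _ _

lemma nonempty_homotopy_zero {K L : CochainComplex C ℤ} [K.IsKProjective] (f : K ⟶ L)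
    (hf : Q.map f = 0) : Nonempty (Homotopy f 0) := by
  refine ⟨HomotopyCategory.homotopyOfEq _ _
    ((CochainComplex.IsKProjective.Qh_map_bijective K _).1 ?_)⟩
  rw [Functor.map_zero, Functor.map_zero]
  exact hf

/-- Morphisms out of a K-projective complex come from chain maps, and there are no nonzero chain
maps to an object placed below the lower bound of `K`. -/
lemma IsProjBounded.finiteProjDim {K : CochainComplex C ℤ} (hK : IsProjBounded K) :
    finiteProjDim C (Q.obj K) := by
  have := hK.isKProjective
  obtain ⟨a, _⟩ := hK.boundedBelow
  refine ⟨a - 1, fun n hn M => eq_zero_of_isKProjective fun f => ?_⟩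
  ext i
  by_cases hi : i = n
  · exact (K.isZero_of_isStrictlyGE a i (by omega)).eq_of_src _ _
  · exact (HomologicalComplex.isZero_single_obj_X _ _ _ _ hi).eq_of_tgt _ _

/-- The canonical map from `K` to `K.opcycles n` placed in degree `n` vanishes in `D(C)`, so it is
null-homotopic. The homotopy retracts `K.opcycles n ⟶ K.X (n + 1)`, whose cokernel `K.opcycles (n +
1)` is then a direct summand of a projective. -/
lemma projective_opcycles (K : CochainComplex C ℤ) [K.IsKProjective] (n : ℤ)
    [Projective (K.X (n + 1))]
    (h : ∀ (M : C) (f : Q.obj K ⟶ (singleFunctor C n).obj M), f = 0) :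
    Projective (K.opcycles (n + 1)) := by
  let φ : K ⟶ (HomologicalComplex.single C (.up ℤ) n).obj (K.opcycles n) :=
    HomologicalComplex.mkHomToSingle (K.pOpcycles n) (fun i _ => K.d_pOpcycles i n)
  obtain ⟨H⟩ := nonempty_homotopy_zero φ (h _ (Q.map φ))
  let s : K.X (n + 1) ⟶ K.opcycles n :=
    H.hom (n + 1) n ≫ (HomologicalComplex.singleObjXSelf (.up ℤ) n (K.opcycles n)).hom
  have hs : K.d n (n + 1) ≫ s = K.pOpcycles n := by
    have := H.comm n
    rw [dNext_eq H.hom (show (ComplexShape.up ℤ).Rel n (n + 1) by simp),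
      prevD_eq H.hom (show (ComplexShape.up ℤ).Rel (n - 1) n by simp),
      HomologicalComplex.mkHomToSingle_f] at this
    simp only [HomologicalComplex.single_obj_d, comp_zero, add_zero,
      HomologicalComplex.zero_f] at this
    rw [← cancel_mono (HomologicalComplex.singleObjXSelf (.up ℤ) n (K.opcycles n)).inv, this]
    simp [s]
  -- `𝟙 - s ≫ fromOpcycles` kills the image of the differential because `d ≫ s` is the projection to
  -- `K.opcycles n`; the map it induces is a section of `K.pOpcycles (n + 1)`.
  let r : K.opcycles (n + 1) ⟶ K.X (n + 1) :=
    K.descOpcycles (𝟙 _ - s ≫ K.fromOpcycles n (n + 1)) n (by simp) (by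
      rw [Preadditive.comp_sub, reassoc_of% hs]
      simp)
  refine Retract.projective (Y := K.X (n + 1)) ⟨r, K.pOpcycles (n + 1), ?_⟩
  rw [← cancel_epi (K.pOpcycles (n + 1))]
  have : K.fromOpcycles n (n + 1) ≫ K.pOpcycles (n + 1) = 0 := by
    rw [← cancel_epi (K.pOpcycles n)]
    simp
  simp [r, this]

lemma perfect_of_iso_Q_obj (X : DerivedCategory.Bounded C) {K : CochainComplex C ℤ}
    (hK : IsProjBounded K) (e : X.obj ≅ Q.obj K) : perfect C X :=
  ⟨⟨(HomotopyCategory.quotient _ _).obj K, hK⟩, ⟨t.bounded.fullyFaithfulι.preimageIso e.symm⟩⟩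

lemma perfect_iff_exists (X : DerivedCategory.Bounded C) :
    perfect C X ↔ ∃ K : CochainComplex C ℤ, IsProjBounded K ∧ Nonempty (X.obj ≅ Q.obj K) :=
  ⟨fun ⟨K, ⟨e⟩⟩ => ⟨K.obj.as, K.property, ⟨t.bounded.ι.mapIso e.symm⟩⟩,
    fun ⟨_, hK, ⟨e⟩⟩ => perfect_of_iso_Q_obj X hK e⟩

lemma exists_isProjMinus_iso [EnoughProjectives C] (X : DerivedCategory.Minus C) :
    ∃ K : CochainComplex C ℤ, IsProjMinus K ∧ Nonempty (X.obj ≅ Q.obj K) :=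
  ⟨((projEquivalence C).inverse.obj X).obj.as, ((projEquivalence C).inverse.obj X).property,
    ⟨t.minus.ι.mapIso ((projEquivalence C).counitIso.app X).symm⟩⟩

/-- For the converse, a projective resolution is truncated at a degree low enough that the
truncation is a quasi-isomorphism and its new leftmost term is projective. -/
lemma perfect_iff_finiteProjDim [EnoughProjectives C] (X : DerivedCategory.Bounded C) :
    perfect C X ↔ finiteProjDim C X.obj := by
  constructor
  · rw [perfect_iff_exists]
    rintro ⟨K, hK, ⟨e⟩⟩
    exact (finiteProjDim C).prop_of_iso e.symm hK.finiteProjDim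
  · intro hX
    obtain ⟨K, hK, ⟨e⟩⟩ := exists_isProjMinus_iso ((boundedToMinus C).obj X)
    obtain ⟨a, ha⟩ := (finiteProjDim C).prop_of_iso e hX
    obtain ⟨c, hc⟩ := X.property.1
    have : t.IsGE ((boundedToMinus C).obj X).obj c := hc
    have : K.IsGE c := (isGE_Q_obj_iff K c).1 (t.isGE_of_iso e c)
    -- The degree `min a (c - 1)` is at most `a`, where morphisms to single objects vanish, and its
    -- successor is at most `c`, so truncating there does not change the homology.
    have := K.isGE_of_ge (min a (c - 1) + 1) c (by omega)
    have := hK.isKProjective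
    have := hK.projective
    exact perfect_of_iso_Q_obj X
      (hK.truncGE _ (projective_opcycles K (min a (c - 1)) (ha _ (min_le_left _ _))))
      (e ≪≫ asIso (Q.map (K.πTruncGE (min a (c - 1) + 1))))

end FiniteProjectiveDimension

end SingularityCategory

namespace SingularityCategory

/-! ### Exactness after applying a functor of finite homological dimension -/

section Syzygies

variable {C : Type u₁} [Category.{v₁} C] [Abelian C] {D : Type u₂} [Category.{v₂} D] [Abelian D]

open ComplexShape in
/-- If `K` is exact in degrees `< a`, then its terms in degrees `≤ a` form a projective
resolution. -/
noncomputable def resolutionOfExact (K : CochainComplex C ℤ) (a : ℤ)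
    (hK : ∀ i, Projective (K.X i)) (hK' : ∀ i < a, K.ExactAt i) :
    ProjectiveResolution ((K.restriction (embeddingUpIntLE a)).opcycles 0) where
  complex := K.restriction (embeddingUpIntLE a)
  projective n := hK _
  π := (ChainComplex.toSingle₀Equiv _ _).symm
    ⟨(K.restriction (embeddingUpIntLE a)).pOpcycles 0, HomologicalComplex.d_pOpcycles _ _ _⟩
  quasiIso := ⟨fun n => by
    cases n with
    | zero =>
      rw [ChainComplex.quasiIsoAt₀_iff, ShortComplex.quasiIso_iff_of_zeros' _ _ rfl rfl]
      · let S := ShortComplex.mk _ _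
          ((K.restriction (embeddingUpIntLE a)).d_pOpcycles 1 0)
        refine (ShortComplex.exact_and_epi_g_iff_of_iso (S₂ := S) ?_).2
          ⟨S.exact_of_g_is_cokernel
            ((K.restriction (embeddingUpIntLE a)).opcyclesIsCokernel 1 0 (by simp)),
            inferInstanceAs (Epi (HomologicalComplex.pOpcycles _ _))⟩
        exact ShortComplex.isoMk (Iso.refl _) (Iso.refl _) (Iso.refl _)
          ((Category.id_comp _).trans (Category.comp_id _).symm)
          ((Category.id_comp _).trans ((ChainComplex.toSingle₀Equiv_symm_apply_f_zero _
            (HomologicalComplex.d_pOpcycles _ _ _)).symm.trans (Category.comp_id _).symm))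
      · exact HomologicalComplex.shape _ _ _ (by simp)
    | succ n =>
      rw [quasiIsoAt_iff_exactAt']
      · rw [HomologicalComplex.exactAt_iff_isZero_homology]
        exact (hK' (a - (n + 1)) (by omega)).isZero_homology.of_iso
          (K.restrictionHomologyIso (embeddingUpIntLE a) (n + 2) (n + 1) n (by simp) (by simp)
            (i' := a - (n + 2)) (k' := a - n) (by simp) (by simp) (by simp) (by simp; omega)
            (by simp; omega))
      · apply ChainComplex.exactAt_succ_single_obj⟩

/-- The terms of `K` in degrees `≤ a` resolve a syzygy, so the homology of `F K` in degree `a - (n +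
1)` is the value of `L_{n+1} F` on this syzygy. -/
lemma exactAt_map_of_isZero_leftDerived [EnoughProjectives C] (F : C ⥤ D) [F.Additive]
    (K : CochainComplex C ℤ) (a : ℤ) (hK : ∀ i, Projective (K.X i))
    (hK' : ∀ i < a, K.ExactAt i) (n : ℕ) (hF : IsZero (F.leftDerived (n + 1))) :
    ((F.mapHomologicalComplex (.up ℤ)).obj K).ExactAt (a - (n + 1)) := by
  rw [HomologicalComplex.exactAt_iff_isZero_homology]
  have h := (F.leftDerived (n + 1)).isZero_iff.1 hF
    ((K.restriction (ComplexShape.embeddingUpIntLE a)).opcycles 0)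
  exact (h.of_iso ((resolutionOfExact K a hK hK').isoLeftDerivedObj F (n + 1)).symm).of_iso
    (((F.mapHomologicalComplex (.up ℤ)).obj K).restrictionHomologyIso
      (ComplexShape.embeddingUpIntLE a) (n + 2) (n + 1) n (by simp) (by simp)
      (i' := a - (n + 2)) (k' := a - n) (by simp) (by simp) (by simp) (by simp; omega)
      (by simp; omega)).symm

lemma exists_exact_map_of_isZero_leftDerived [EnoughProjectives C] (F : C ⥤ D) [F.Additive]
    (hF : ∃ N : ℕ, ∀ n : ℕ, N ≤ n → IsZero (F.leftDerived n)) {K : CochainComplex C ℤ} {a : ℤ}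
    (hK : IsProjMinus K) (ha : ∀ i < a, K.ExactAt i) :
    ∃ a' : ℤ, ∀ i < a', ((F.mapHomologicalComplex (.up ℤ)).obj K).ExactAt i := by
  obtain ⟨N, hN⟩ := hF
  refine ⟨a - N, fun i hi => ?_⟩
  obtain ⟨n, rfl⟩ : ∃ n : ℕ, i = a - (n + 1) := ⟨(a - i - 1).toNat, by omega⟩
  exact exactAt_map_of_isZero_leftDerived F K a hK.projective ha n (hN _ (by omega))

end Syzygies

/-! ### Zero objects of the singularity category -/

section Quotient

open DerivedCategory DerivedCategory.TStructure ZeroObject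

variable (C : Type u) [Category.{v} C] [Abelian C] [HasDerivedCategory.{w} C]

instance [EnoughProjectives C] : (perfect C).IsStableUnderRetracts where
  of_retract {X Y} h hY := by
    rw [perfect_iff_finiteProjDim] at hY ⊢
    exact (finiteProjDim C).prop_of_retract (h.map Bounded.ι) hY

lemma isZero_Q_obj_iff [EnoughProjectives C] (X : DerivedCategory.Bounded C) :
    IsZero ((Dsg.Q C).obj X) ↔ perfect C X := by
  constructor
  · intro hX
    -- If `X` becomes zero, then some `s : Y ⟶ X` with perfect cone `Z` is zero; hence `𝟙 X` factors
    -- through `X ⟶ Z`, and `X` is a retract of `Z`.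
    obtain ⟨Y, s, ⟨Z, g, k, hT, hZ⟩, hs⟩ :=
      (MorphismProperty.map_eq_iff_precomp (Dsg.Q C) (perfect C).trW (𝟙 X) 0).1
        (hX.eq_of_src _ _)
    obtain ⟨r, hr⟩ := Triangle.yoneda_exact₂ _ hT (𝟙 X) (hs.trans comp_zero)
    exact (perfect C).prop_of_retract ⟨g, r, hr.symm⟩ hZ
  · intro hX
    -- The cone of `0 ⟶ X` is `X` itself.
    have : IsIso ((Dsg.Q C).map (0 : 0 ⟶ X)) := Localization.inverts (Dsg.Q C) (perfect C).trW _
      (ObjectProperty.trW.mk _ (contractible_distinguished₁ X) hX)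
    exact ((Dsg.Q C).map_isZero (isZero_zero _)).of_iso (asIso ((Dsg.Q C).map (0 : 0 ⟶ X))).symm

end Quotient

/-! ### Boundedness and perfection of derived functors -/

section Derived

open DerivedCategory DerivedCategory.TStructure

lemma finiteProjDim_map_of_isProjBounded
    {C : Type u₁} [Category.{v₁} C] [Abelian C] {D : Type u₂} [Category.{v₂} D] [Abelian D]
    [HasDerivedCategory.{w₂} D] (F : C ⥤ D) [F.Additive] {K : CochainComplex C ℤ} (hK : IsProjBounded K)
    (hF : ∀ P : C, Projective P → projectiveDimension (F.obj P) < ⊤) :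
    finiteProjDim D (Q.obj ((F.mapHomologicalComplex (.up ℤ)).obj K)) := by
  obtain ⟨a, _⟩ := hK.boundedBelow
  obtain ⟨b, _⟩ := hK.boundedAbove
  exact prop_Q_obj_of_prop_singleFunctor _ _ a b
    fun i => (finiteProjDim_singleFunctor_iff _ _).2 (hF _ (hK.projective i))

variable {C : Type u₁} [Category.{v₁} C] [Abelian C] [HasDerivedCategory.{w₁} C]
  {D : Type u₂} [Category.{v₂} D] [Abelian D] [HasDerivedCategory.{w₂} D]
  (F : C ⥤ D) [F.Additive] [EnoughProjectives C]

/-- The derived functor `𝕃F` is computed by any projective resolution. -/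
noncomputable def leftDerivedMinusIso (X : DerivedCategory.Minus C) {K : CochainComplex C ℤ}
    (hK : IsProjMinus K) (e : X.obj ≅ Q.obj K) :
    ((leftDerivedMinus F).obj X).obj ≅ Q.obj ((F.mapHomologicalComplex (.up ℤ)).obj K) :=
  let K' : KMinusProj C := ⟨(HomotopyCategory.quotient _ _).obj K, hK⟩
  let e' : X ≅ (projEquivalence C).functor.obj K' := t.minus.fullyFaithfulι.preimageIso e
  t.minus.ι.mapIso ((mapKMinusProj F).mapIso
    ((projEquivalence C).inverse.mapIso e' ≪≫ (projEquivalence C).unitIso.symm.app K'))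

omit [EnoughProjectives C] in
lemma exists_exact_of_isProjMinus_iso (X : DerivedCategory.Bounded C) {K : CochainComplex C ℤ}
    (e : X.obj ≅ Q.obj K) : ∃ a : ℤ, ∀ i < a, K.ExactAt i := by
  obtain ⟨a, ha⟩ := X.property.1
  have : t.IsGE X.obj a := ha
  have : K.IsGE a := (isGE_Q_obj_iff K a).1 (t.isGE_of_iso e a)
  exact ⟨a, fun i hi => K.exactAt_of_isGE a i hi⟩

/-- Phrased through exactness in low degrees rather than through vanishing of derived functors, so
that it also serves for `l`, where exactness is deduced from that of `F`. -/
lemma preservesBounded_of_exact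
    (h : ∀ K : CochainComplex C ℤ, IsProjMinus K → (∃ a : ℤ, ∀ i < a, K.ExactAt i) →
      ∃ a : ℤ, ∀ i < a, ((F.mapHomologicalComplex (.up ℤ)).obj K).ExactAt i) :
    PreservesBounded F := by
  intro X
  obtain ⟨K, hK, ⟨e⟩⟩ := exists_isProjMinus_iso ((boundedToMinus C).obj X)
  obtain ⟨a, ha⟩ := h K hK (exists_exact_of_isProjMinus_iso X e)
  have := (CochainComplex.isGE_iff _ _).2 ha
  refine ⟨⟨a, ?_⟩, ((leftDerivedMinus F).obj ((boundedToMinus C).obj X)).property⟩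
  exact t.isGE_of_iso (leftDerivedMinusIso F _ hK e).symm a

lemma preservesBounded_of_isZero_leftDerived
    (hF : ∃ N : ℕ, ∀ n : ℕ, N ≤ n → IsZero (F.leftDerived n)) : PreservesBounded F :=
  preservesBounded_of_exact F
    fun _ hK ⟨_, ha⟩ => exists_exact_map_of_isZero_leftDerived F hF hK ha

omit [EnoughProjectives C] in
lemma preservesPerfect_mapBounded [EnoughProjectives D] [PreservesFiniteLimits F]
    [PreservesFiniteColimits F]
    (hF : ∀ P : C, Projective P → projectiveDimension (F.obj P) < ⊤) :
    PreservesPerfect (mapBounded F) := by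
  intro X hX
  obtain ⟨K, hK, ⟨e⟩⟩ := (perfect_iff_exists X).1 hX
  rw [perfect_iff_finiteProjDim]
  exact (finiteProjDim D).prop_of_iso
    (F.mapDerivedCategory.mapIso e ≪≫ F.mapDerivedCategoryFactors.app K).symm
    (finiteProjDim_map_of_isProjBounded F hK hF)

lemma preservesPerfect_leftDerivedBounded [EnoughProjectives D] (h : PreservesBounded F)
    (hF : ∀ P : C, Projective P → projectiveDimension (F.obj P) < ⊤) :
    PreservesPerfect (leftDerivedBounded F h) := by
  intro X hX
  obtain ⟨K, hK, ⟨e⟩⟩ := (perfect_iff_exists X).1 hX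
  rw [perfect_iff_finiteProjDim]
  exact (finiteProjDim D).prop_of_iso
    (leftDerivedMinusIso F ((boundedToMinus C).obj X) hK.toIsProjMinus e).symm
    (finiteProjDim_map_of_isProjBounded F hK hF)

end Derived

end SingularityCategory

/-! ### Adjunctions on complexes and homotopy categories -/

namespace CategoryTheory

section

variable {C : Type u₁} [Category.{v₁} C] {D : Type u₂} [Category.{v₂} D]

/-- The adjunction given by a natural transformation whose components are universal arrows. -/
noncomputable def Adjunction.ofUniversalUnit {F : C ⥤ D} {G : D ⥤ C} (η : 𝟭 C ⟶ F ⋙ G)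
    (h : ∀ (X : C) (Y : D),
      Function.Bijective (fun f : F.obj X ⟶ Y => η.app X ≫ G.map f)) : F ⊣ G :=
  Adjunction.mkOfHomEquiv
    { homEquiv X Y := Equiv.ofBijective _ (h X Y)
      homEquiv_naturality_left_symm {X' X Y} f g := by
        obtain ⟨g, rfl⟩ := (Equiv.ofBijective _ (h X Y)).surjective g
        rw [Equiv.symm_apply_apply, Equiv.symm_apply_eq]
        simp [← reassoc_of% (η.naturality f)] }

lemma Adjunction.ofUniversalUnit_unit {F : C ⥤ D} {G : D ⥤ C} (η : 𝟭 C ⟶ F ⋙ G)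
    (h : ∀ (X : C) (Y : D),
      Function.Bijective (fun f : F.obj X ⟶ Y => η.app X ≫ G.map f)) :
    (Adjunction.ofUniversalUnit η h).unit = η := by
  ext X
  simp [Adjunction.ofUniversalUnit]

variable [Preadditive C] [Preadditive D] {F : C ⥤ D} {G : D ⥤ C} (adj : F ⊣ G)
  [F.Additive] [G.Additive] {ι : Type*} (c : ComplexShape ι)

/-- The adjunction between categories of complexes induced by an adjunction. -/
def Adjunction.mapHomologicalComplex : F.mapHomologicalComplex c ⊣ G.mapHomologicalComplex c where
  unit :=
    { app K := { f i := adj.unit.app (K.X i), comm' _ _ _ := (adj.unit.naturality _).symm }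
      naturality _ _ f := by ext i; exact adj.unit.naturality (f.f i) }
  counit :=
    { app K := { f i := adj.counit.app (K.X i), comm' _ _ _ := (adj.counit.naturality _).symm }
      naturality _ _ f := by ext i; exact adj.counit.naturality (f.f i) }
  left_triangle_components K := by ext i; exact adj.left_triangle_components (K.X i)
  right_triangle_components K := by ext i; exact adj.right_triangle_components (K.X i)

/-- The adjunction between homotopy categories induced by an adjunction. -/
def Adjunction.mapHomotopyCategory : F.mapHomotopyCategory c ⊣ G.mapHomotopyCategory c where
  unit :=
    { app K := (HomotopyCategory.quotient C c).map ((adj.mapHomologicalComplex c).unit.app K.as)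
      naturality := by
        rintro ⟨K⟩ ⟨L⟩ ⟨f : K ⟶ L⟩
        exact congr_arg (HomotopyCategory.quotient C c).map
          ((adj.mapHomologicalComplex c).unit.naturality f) }
  counit :=
    { app K := (HomotopyCategory.quotient D c).map ((adj.mapHomologicalComplex c).counit.app K.as)
      naturality := by
        rintro ⟨K⟩ ⟨L⟩ ⟨f : K ⟶ L⟩
        exact congr_arg (HomotopyCategory.quotient D c).map
          ((adj.mapHomologicalComplex c).counit.naturality f) }
  left_triangle_components K := congr_arg (HomotopyCategory.quotient D c).map
    ((adj.mapHomologicalComplex c).left_triangle_components K.as)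
  right_triangle_components K := congr_arg (HomotopyCategory.quotient C c).map
    ((adj.mapHomologicalComplex c).right_triangle_components K.as)

end

end CategoryTheory

/-! ### The derived adjunction on bounded derived categories -/

namespace SingularityCategory

/-- A left adjoint of a functor preserving epimorphisms preserves projectives. In the derived
adjunction this makes the image of a projective resolution K-projective again. -/
lemma IsProjMinus.map {C : Type u₁} [Category.{v₁} C] [Abelian C]
    {D : Type u₂} [Category.{v₂} D] [Abelian D] {F : C ⥤ D} {G : D ⥤ C} [F.Additive]
    [G.PreservesEpimorphisms] (adj : F ⊣ G) {K : CochainComplex C ℤ} (hK : IsProjMinus K) :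
    IsProjMinus ((F.mapHomologicalComplex (.up ℤ)).obj K) where
  projective n := adj.map_projective _ (hK.projective n)
  boundedAbove := by
    obtain ⟨b, _⟩ := hK.boundedAbove
    exact ⟨b, inferInstance⟩

open DerivedCategory DerivedCategory.TStructure

variable {C : Type u₁} [Category.{v₁} C] [Abelian C] [HasDerivedCategory.{w₁} C]
  [EnoughProjectives C]
  {D : Type u₂} [Category.{v₂} D] [Abelian D] [HasDerivedCategory.{w₂} D]
  {F : C ⥤ D} {G : D ⥤ C} [F.Additive] [G.Additive] [PreservesFiniteLimits G]
  [PreservesFiniteColimits G] (adj : F ⊣ G)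

variable (C) in
/-- An object of `Dᵇ(C)` is isomorphic to its projective resolution in `D(C)`. -/
noncomputable def projEquivalenceCounitIso : Bounded.ι ≅
    boundedToMinus C ⋙ (projEquivalence C).inverse ⋙ ObjectProperty.ι _ ⋙ Qh :=
  NatIso.ofComponents
    (fun X => t.minus.ι.mapIso ((projEquivalence C).counitIso.symm.app ((boundedToMinus C).obj X)))
    (fun {X Y} f => by
      have := t.minus.ι.congr_map
        ((projEquivalence C).counitIso.inv.naturality ((boundedToMinus C).map f))
      rw [Functor.map_comp, Functor.map_comp] at this
      exact this)

/-- The unit of the derived adjunction, as a natural transformation with values in `D(C)`. -/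
noncomputable def derivedUnit (hF : PreservesBounded F) :
    Bounded.ι ⟶ (leftDerivedBounded F hF ⋙ mapBounded G) ⋙ Bounded.ι :=
  (projEquivalenceCounitIso C).hom ≫
    Functor.whiskerLeft (boundedToMinus C ⋙ (projEquivalence C).inverse ⋙ ObjectProperty.ι _)
      (Functor.whiskerRight (adj.mapHomotopyCategory (.up ℤ)).unit Qh ≫
        Functor.whiskerLeft (F.mapHomotopyCategory (.up ℤ)) G.mapDerivedCategoryFactorsh.inv)

/-- The unit of the derived adjunction. -/
noncomputable def derivedBoundedUnit (hF : PreservesBounded F) :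
    𝟭 (DerivedCategory.Bounded C) ⟶ leftDerivedBounded F hF ⋙ mapBounded G :=
  ((Functor.FullyFaithful.whiskeringRight t.bounded.fullyFaithfulι _).preimage
    ((Functor.leftUnitor _).hom ≫ derivedUnit adj hF))

lemma ι_map_derivedBoundedUnit_app (hF : PreservesBounded F) (X : DerivedCategory.Bounded C) :
    Bounded.ι.map ((derivedBoundedUnit adj hF).app X) =
      (projEquivalenceCounitIso C).hom.app X ≫
        Qh.map ((adj.mapHomotopyCategory (.up ℤ)).unit.app
          ((projEquivalence C).inverse.obj ((boundedToMinus C).obj X)).obj) ≫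
        G.mapDerivedCategoryFactorsh.inv.app _ := by
  have := NatTrans.congr_app
    ((Functor.FullyFaithful.whiskeringRight t.bounded.fullyFaithfulι _).map_preimage
      ((Functor.leftUnitor _).hom ≫ derivedUnit adj hF)) X
  exact this.trans (Category.id_comp _)

/-- Let `P` be a projective resolution of `X`. Both `P` and `F P` are K-projective, so morphisms out
of them in the derived category can be computed up to homotopy, and the claim reduces to the
termwise adjunction `Hom(F P, Y') ≃ Hom(P, G Y')`. -/
lemma derivedBoundedUnit_universal (hF : PreservesBounded F) (X : DerivedCategory.Bounded C)
    (Y : DerivedCategory.Bounded D) :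
    Function.Bijective (fun f : (leftDerivedBounded F hF).obj X ⟶ Y =>
      (derivedBoundedUnit adj hF).app X ≫ (mapBounded G).map f) := by
  let P := ((projEquivalence C).inverse.obj ((boundedToMinus C).obj X)).obj
  have hP : IsProjMinus P.as :=
    ((projEquivalence C).inverse.obj ((boundedToMinus C).obj X)).property
  have := hP.isKProjective
  have := (hP.map adj).isKProjective
  let Y' := Qh.objPreimage Y.obj
  let y : Y.obj ≅ Qh.obj Y' := (Qh.objObjPreimageIso Y.obj).symm
  let a : ((F.mapHomotopyCategory (.up ℤ)).obj P ⟶ Y') ≃ ((leftDerivedBounded F hF).obj X ⟶ Y) :=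
    (Equiv.ofBijective _ (CochainComplex.IsKProjective.Qh_map_bijective
      ((F.mapHomologicalComplex (.up ℤ)).obj P.as) Y')).trans
      (y.symm.homToEquiv.trans
        (t.bounded.fullyFaithfulι.homEquiv (X := (leftDerivedBounded F hF).obj X) (Y := Y)).symm)
  have ha (φ) : Bounded.ι.map (a φ) = Qh.map φ ≫ y.inv :=
    t.bounded.fullyFaithfulι.map_preimage _
  let b : (P ⟶ (G.mapHomotopyCategory (.up ℤ)).obj Y') ≃
      (X ⟶ (mapBounded G).obj Y) :=
    (Equiv.ofBijective _ (CochainComplex.IsKProjective.Qh_map_bijective P.as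
      ((G.mapHomotopyCategory (.up ℤ)).obj Y'))).trans
      (((G.mapDerivedCategoryFactorsh.app Y').symm ≪≫
        G.mapDerivedCategory.mapIso y.symm).homToEquiv.trans
      (((projEquivalenceCounitIso C).app X).symm.homFromEquiv.trans
        (t.bounded.fullyFaithfulι.homEquiv (X := X) (Y := (mapBounded G).obj Y)).symm))
  have hb (ψ) : Bounded.ι.map (b ψ) = (projEquivalenceCounitIso C).hom.app X ≫
      Qh.map ψ ≫ G.mapDerivedCategoryFactorsh.inv.app Y' ≫ G.mapDerivedCategory.map y.inv :=
    t.bounded.fullyFaithfulι.map_preimage _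
  have assoc_aux {X₁ X₂ X₃ X₄ X₅ X₆ X₇ : DerivedCategory C} (f₁ : X₁ ⟶ X₂) (f₂ : X₂ ⟶ X₃)
      (f₃ : X₃ ⟶ X₄) (f₄ : X₄ ⟶ X₆) (f₅ : X₃ ⟶ X₅) (f₆ : X₅ ⟶ X₆) (f₇ : X₆ ⟶ X₇)
      (h : f₅ ≫ f₆ = f₃ ≫ f₄) :
      (f₁ ≫ f₂ ≫ f₃) ≫ f₄ ≫ f₇ = f₁ ≫ (f₂ ≫ f₅) ≫ f₆ ≫ f₇ := by
    simp [reassoc_of% h]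
  -- Under the identifications `a` and `b`, composing with the derived unit becomes the adjunction
  -- bijection of homotopy categories.
  have hab (φ) : (derivedBoundedUnit adj hF).app X ≫ (mapBounded G).map (a φ) =
      b ((adj.mapHomotopyCategory (.up ℤ)).homEquiv P Y' φ) := by
    apply Bounded.ι.map_injective
    have h₁ : Bounded.ι.map ((mapBounded G).map (a φ)) =
      G.mapDerivedCategory.map (Qh.map φ) ≫ G.mapDerivedCategory.map y.inv :=
      (congr_arg G.mapDerivedCategory.map (ha φ)).trans (Functor.map_comp _ _ _)
    have h₂ := G.mapDerivedCategoryFactorsh.inv.naturality φ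
    rw [Functor.map_comp, ι_map_derivedBoundedUnit_app, h₁, hb, Adjunction.homEquiv_unit]
    rw [Functor.map_comp]
    exact assoc_aux _ _ _ _ _ _ _ h₂
  have : (fun f => (derivedBoundedUnit adj hF).app X ≫ (mapBounded G).map f) =
      a.symm.trans (((adj.mapHomotopyCategory (.up ℤ)).homEquiv P Y').trans b) := by
    funext f
    obtain ⟨φ, rfl⟩ := a.surjective f
    simp [hab]
  rw [this]
  exact Equiv.bijective _

/-- The derived adjunction between bounded derived categories induced by an adjunction
with exact right adjoint. -/
noncomputable def derivedBoundedAdjunction (hF : PreservesBounded F) :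
    leftDerivedBounded F hF ⊣ mapBounded G :=
  .ofUniversalUnit (derivedBoundedUnit adj hF) (derivedBoundedUnit_universal adj hF)

end SingularityCategory

/-! ### The natural splitting of `e l` and its consequences -/

namespace CleftExtension

variable {B : Type u₁} [Category.{v₁} B] [Abelian B] {A : Type u₂} [Category.{v₂} A] [Abelian A]
  (S : CleftExtension B A)

/-- The natural retraction of the unit `𝟭 B ⟶ e l`. -/
noncomputable def unitRetraction : S.l ⋙ S.e ⟶ 𝟭 B where
  app X := S.e.map (S.l.map (S.eiIso.inv.app X) ≫ S.adj.counit.app (S.i.obj X)) ≫ S.eiIso.hom.app X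
  naturality X Y f := by
    have h₁ := S.eiIso.inv.naturality f
    have h₂ := S.eiIso.hom.naturality f
    have h₃ := S.adj.counit.naturality (S.i.map f)
    dsimp at h₁ h₂ h₃ ⊢
    rw [Category.assoc, ← h₂, ← S.e.map_comp_assoc, ← S.e.map_comp_assoc, ← S.l.map_comp_assoc,
      h₁, S.l.map_comp, Category.assoc, Category.assoc, h₃]

/-- Naturality of the unit moves the composite from `X` to `e i X`, where it is the triangle
identity. -/
lemma unit_unitRetraction (X : B) : S.adj.unit.app X ≫ S.unitRetraction.app X = 𝟙 X := by
  have h := S.adj.unit.naturality (S.eiIso.inv.app X)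
  dsimp at h
  dsimp [unitRetraction]
  rw [Functor.map_comp, Category.assoc, ← reassoc_of% h, S.adj.right_triangle_components_assoc,
    Iso.inv_hom_id_app]
  rfl

/-- The natural inclusion `F ⟶ e l`. -/
noncomputable def FInclusion : S.F ⟶ S.l ⋙ S.e where
  app X := S.e.map (S.Gι (S.i.obj X) ≫ S.l.map (S.eiIso.hom.app X))
  naturality X Y f := by
    have h := S.eiIso.hom.naturality f
    dsimp [F] at h ⊢
    rw [← S.e.map_comp, ← S.e.map_comp, reassoc_of% (S.G_map_Gι (S.i.map f)), Category.assoc,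
      ← S.l.map_comp, ← S.l.map_comp, h]

lemma Gι_counit (X : A) : S.Gι X ≫ S.adj.counit.app X = 0 := kernel.condition _

lemma FInclusion_unitRetraction (X : B) :
    S.FInclusion.app X ≫ S.unitRetraction.app X = 0 := by
  have h : (S.Gι (S.i.obj X) ≫ S.l.map (S.eiIso.hom.app X)) ≫
      S.l.map (S.eiIso.inv.app X) ≫ S.adj.counit.app (S.i.obj X) = 0 := by
    rw [Category.assoc, ← S.l.map_comp_assoc, Iso.hom_inv_id_app]
    exact (congr_arg (S.Gι _ ≫ ·) ((congr_arg (· ≫ S.adj.counit.app _) (S.l.map_id _)).trans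
      (Category.id_comp _))).trans (S.Gι_counit _)
  have h' := S.e.congr_map h
  rw [Functor.map_comp, Functor.map_zero] at h'
  exact (Category.assoc _ _ _).symm.trans ((congr_arg (· ≫ S.eiIso.hom.app X) h').trans zero_comp)

/-- The natural splitting `e l X ≅ F X ⊞ X`. -/
noncomputable def splitting (X : B) :
    (ShortComplex.mk _ _ (S.FInclusion_unitRetraction X)).Splitting := by
  -- The exact functor `e` carries the kernel sequence of the counit at `i X` to `F X ⟶ e l X ⟶ X`,
  -- up to `e i X ≅ X`; the unit then splits it.
  let T : ShortComplex A := .mk _ _ (S.Gι_counit (S.i.obj X))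
  have hT : T.Exact := T.exact_of_f_is_kernel (kernelIsKernel _)
  let e : T.map S.e ≅ ShortComplex.mk _ _ (S.FInclusion_unitRetraction X) :=
    ShortComplex.isoMk (Iso.refl _) (S.e.mapIso (S.l.mapIso (S.eiIso.app X))) (S.eiIso.app X)
      ((Category.id_comp _).trans (S.e.map_comp _ _))
      (by
        change S.e.map (S.l.map (S.eiIso.hom.app X)) ≫ S.e.map (_ ≫ _) ≫ S.eiIso.hom.app X =
          S.e.map (S.adj.counit.app (S.i.obj X)) ≫ S.eiIso.hom.app X
        rw [← S.e.map_comp_assoc, ← S.l.map_comp_assoc, Iso.hom_inv_id_app]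
        simp)
  have : Mono (S.FInclusion.app X) :=
    have : Mono (S.Gι (S.i.obj X) ≫ S.l.map (S.eiIso.hom.app X)) := mono_comp _ _
    inferInstanceAs (Mono (S.e.map (S.Gι (S.i.obj X) ≫ S.l.map (S.eiIso.hom.app X))))
  exact ShortComplex.Splitting.ofExactOfSection _
    (ShortComplex.exact_of_iso e (hT.map S.e)) (S.adj.unit.app X) (S.unit_unitRetraction X) this

lemma splitting_r_FInclusion (X : B) : (S.splitting X).r ≫ S.FInclusion.app X =
    𝟙 _ - S.unitRetraction.app X ≫ S.adj.unit.app X :=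
  (S.splitting X).r_f

/-- The natural projection `e l ⟶ F`. -/
noncomputable def FProjection : S.l ⋙ S.e ⟶ S.F where
  app X := (S.splitting X).r
  naturality X Y f := by
    -- After composition with the monic inclusion, the projection becomes `𝟙` minus retraction
    -- followed by unit, which is visibly natural.
    have : Mono (S.FInclusion.app Y) := (S.splitting Y).mono_f
    rw [← cancel_mono (S.FInclusion.app Y), Category.assoc, Category.assoc,
      S.FInclusion.naturality, splitting_r_FInclusion, reassoc_of% (S.splitting_r_FInclusion X),
      Preadditive.comp_sub, Preadditive.sub_comp, S.unitRetraction.naturality_assoc, Category.assoc,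
      ← S.adj.unit.naturality, Category.comp_id, Category.id_comp]

lemma unit_FProjection (X : B) : S.adj.unit.app X ≫ S.FProjection.app X = 0 :=
  (S.splitting X).s_r

/-- The splitting of `F X ⟶ e l X ⟶ X` read backwards, with inclusions and projections exchanged. -/
lemma shortExact_unit_FProjection (X : B) :
    (ShortComplex.mk _ _ (S.unit_FProjection X)).ShortExact :=
  ShortComplex.Splitting.shortExact
    { r := S.unitRetraction.app X
      s := S.FInclusion.app X
      f_r := S.unit_unitRetraction X
      s_g := (S.splitting X).f_r
      id := (add_comm _ _).trans (S.splitting X).id }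

/-- The exact sequence `0 ⟶ K ⟶ e l K ⟶ F K ⟶ 0` for a cochain complex `K`. -/
noncomputable abbrev shortComplex (K : CochainComplex B ℤ) :
    ShortComplex (CochainComplex B ℤ) where
  X₁ := K
  X₂ := (S.e.mapHomologicalComplex _).obj ((S.l.mapHomologicalComplex _).obj K)
  X₃ := (S.F.mapHomologicalComplex _).obj K
  f := (S.adj.mapHomologicalComplex _).unit.app K
  g :=
    { f i := S.FProjection.app (K.X i)
      comm' i j _ := (S.FProjection.naturality (K.d i j)).symm }
  zero := by
    ext i
    exact S.unit_FProjection (K.X i)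

lemma shortExact_shortComplex (K : CochainComplex B ℤ) : (S.shortComplex K).ShortExact :=
  HomologicalComplex.shortExact_of_degreewise_shortExact _
    fun i => S.shortExact_unit_FProjection (K.X i)

/-- The long exact homology sequence gives exactness of `e l K`, and a faithful exact functor
reflects exactness. -/
lemma exactAt_map_l {K : CochainComplex B ℤ} {i : ℤ} (hK : K.ExactAt i)
    (hFK : ((S.F.mapHomologicalComplex (.up ℤ)).obj K).ExactAt i) :
    ((S.l.mapHomologicalComplex (.up ℤ)).obj K).ExactAt i := by
  have h : (S.shortComplex K).X₂.ExactAt i := by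
    rw [HomologicalComplex.exactAt_iff_isZero_homology]
    exact ((S.shortExact_shortComplex K).homology_exact₂ i).isZero_X₂
      (hK.isZero_homology.eq_of_src _ _) (hFK.isZero_homology.eq_of_tgt _ _)
  exact (ShortComplex.exact_map_iff_of_faithful _ S.e).1 h

/-- The counit is epi, because `e` is faithful and sends it to a split epi. So `P` is a retract of
`l Q` with `Q` projective, and `e l Q` is an extension of `F Q` by `Q`. -/
lemma projectiveDimension_e_lt_top_of_projective [EnoughProjectives B]
    (ha : ∀ P : B, Projective P → projectiveDimension (S.F.obj P) < ⊤)
    (P : A) (hP : Projective P) : projectiveDimension (S.e.obj P) < ⊤ := by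
  let Q := Projective.over (S.e.obj P)
  let π : S.l.obj Q ⟶ P := S.l.map (Projective.π _) ≫ S.adj.counit.app P
  have : Epi (S.adj.counit.app P) := by
    have : Epi (S.e.map (S.adj.counit.app P)) :=
      (SplitEpi.mk _ (S.adj.right_triangle_components P)).epi
    exact S.e.epi_of_epi_map this
  have := S.adj.isLeftAdjoint
  have : Epi π := epi_comp _ _
  have h : Retract P (S.l.obj Q) := ⟨_, π, Projective.factorThru_comp (𝟙 P) π⟩
  refine (h.map S.e).projectiveDimension_le.trans_lt ?_
  obtain ⟨n, hn⟩ := (SingularityCategory.projectiveDimension_lt_top_iff_exists _).1 (ha Q inferInstance)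
  have hQ : HasProjectiveDimensionLT Q (n + 1) := hasProjectiveDimensionLT_of_ge Q 1 _ (by omega)
  have hFQ : HasProjectiveDimensionLT (S.F.obj Q) (n + 1) :=
    hasProjectiveDimensionLT_of_ge _ n _ (by omega)
  exact (SingularityCategory.projectiveDimension_lt_top_iff_exists _).2
    ⟨n + 1, (S.shortExact_unit_FProjection Q).hasProjectiveDimensionLT_X₂ _ hQ hFQ⟩

end CleftExtension

/-! ### Conservative triangle functors and conservative right adjoints -/

namespace CategoryTheory

/-- A morphism is invertible exactly when its cone is zero. -/
lemma Functor.reflectsIsomorphisms_of_isZero {C D : Type*} [Category* C] [Category* D]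
    [HasZeroObject C] [HasZeroObject D]
    [Preadditive C] [Preadditive D] [HasShift C ℤ] [HasShift D ℤ]
    [∀ n : ℤ, (shiftFunctor C n).Additive] [∀ n : ℤ, (shiftFunctor D n).Additive]
    [Pretriangulated C] [Pretriangulated D] (Φ : C ⥤ D) [Φ.CommShift ℤ] [Φ.IsTriangulated]
    (h : ∀ X, IsZero (Φ.obj X) → IsZero X) : Φ.ReflectsIsomorphisms where
  reflects {X Y} f hf := by
    obtain ⟨Z, g, k, hT⟩ := distinguished_cocone_triangle f
    exact (Triangle.isZero₃_iff_isIso₁ _ hT).1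
      (h _ ((Triangle.isZero₃_iff_isIso₁ _ (Φ.map_distinguished _ hT)).2 hf))

/-- If the unit is invertible, a triangle identity makes `G` of the counit invertible, and `G`
reflects this. -/
lemma Adjunction.isEquivalence_right_iff_isIso_unit {C D : Type*} [Category* C] [Category* D]
    {F : C ⥤ D} {G : D ⥤ C} (adj : F ⊣ G) [G.ReflectsIsomorphisms] :
    G.IsEquivalence ↔ IsIso adj.unit := by
  constructor
  · intro _
    have := adj.isEquivalence_left_of_isEquivalence_right
    infer_instance
  · intro _
    have : IsIso adj.counit := by
      have (Y : D) : IsIso (adj.counit.app Y) := by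
        have : IsIso (G.map (adj.counit.app Y)) := by
          rw [← isIso_comp_left_iff (adj.unit.app (G.obj Y)), adj.right_triangle_components]
          exact IsIso.id _
        exact isIso_of_reflects_iso _ G
      exact NatIso.isIso_of_isIso_app _
    exact adj.toEquivalence.isEquivalence_inverse

end CategoryTheory

/-! ### Vanishing of functors between singularity categories -/

namespace SingularityCategory

open DerivedCategory DerivedCategory.TStructure

section

variable {C : Type u} [Category.{v} C] [Abelian C] [HasDerivedCategory.{w} C]
variable {D : Type u₁} [Category.{v₁} D] [Abelian D] [HasDerivedCategory.{w₁} D]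
  (Φ : DerivedCategory.Bounded C ⥤ DerivedCategory.Bounded D) [Φ.CommShift ℤ]
  [Φ.IsTriangulated] (h : PreservesPerfect Φ)

noncomputable instance : CatCommSq Φ (Dsg.Q C) (Dsg.Q D) (singFunctor Φ h) :=
  ⟨(singFunctorFactors Φ h).symm⟩

lemma isZero_singFunctor_obj_Q_iff [EnoughProjectives D] (X : DerivedCategory.Bounded C) :
    IsZero ((singFunctor Φ h).obj ((Dsg.Q C).obj X)) ↔ finiteProjDim D (Φ.obj X).obj := by
  rw [← perfect_iff_finiteProjDim, ← isZero_Q_obj_iff]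
  exact ((singFunctorFactors Φ h).app X).isZero_iff

lemma isZero_singFunctor_iff [EnoughProjectives D] :
    IsZero (singFunctor Φ h) ↔
      ∀ X : DerivedCategory.Bounded C, finiteProjDim D (Φ.obj X).obj := by
  rw [Functor.isZero_iff]
  simp only [← isZero_singFunctor_obj_Q_iff Φ h]
  refine ⟨fun H X => H _, fun H X => ?_⟩
  have : (Dsg.Q C).EssSurj := Localization.essSurj _ (perfect C).trW
  exact (H _).of_iso ((singFunctor Φ h).mapIso ((Dsg.Q C).objObjPreimageIso X).symm)

end

end SingularityCategory

/-! ### The derived unit and conservativity of `e` -/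

namespace CleftExtension

open DerivedCategory DerivedCategory.TStructure SingularityCategory

variable {B : Type u₁} [Category.{v₁} B] [Abelian B] [EnoughProjectives B]
  [HasDerivedCategory.{w₁} B]
  {A : Type u₂} [Category.{v₂} A] [Abelian A]
  [HasDerivedCategory.{w₂} A] (S : CleftExtension B A)

lemma preservesBounded_l (hb : ∃ N : ℕ, ∀ n : ℕ, N ≤ n → IsZero (S.F.leftDerived n)) :
    PreservesBounded S.l := by
  refine preservesBounded_of_exact S.l fun K hK ⟨a, ha⟩ => ?_
  obtain ⟨a', ha'⟩ := exists_exact_map_of_isZero_leftDerived S.F hb hK ha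
  exact ⟨min a a', fun i hi => S.exactAt_map_l (ha i (by omega)) (ha' i (by omega))⟩

/-- The cone of the derived unit at `X` is `𝕃F X`: on a projective resolution `K`, the unit is the
first map of `0 ⟶ K ⟶ e l K ⟶ F K ⟶ 0`. -/
lemma isIso_Q_map_unit_iff (hl : PreservesBounded S.l) (hF : PreservesBounded S.F)
    (X : DerivedCategory.Bounded B) :
    IsIso ((Dsg.Q B).map ((derivedBoundedAdjunction S.adj hl).unit.app X)) ↔
      finiteProjDim B ((leftDerivedBounded S.F hF).obj X).obj := by
  obtain ⟨Z, g, k, hT⟩ := distinguished_cocone_triangle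
    ((derivedBoundedAdjunction S.adj hl).unit.app X)
  have h₁ := Triangle.isZero₃_iff_isIso₁ _ ((Dsg.Q B).map_distinguished _ hT)
  refine h₁.symm.trans ((isZero_Q_obj_iff B Z).trans ((perfect_iff_finiteProjDim Z).trans
    ((finiteProjDim B).prop_iff_of_iso ?_)))
  let K := ((projEquivalence B).inverse.obj ((boundedToMinus B).obj X)).obj.as
  refine Triangle.π₃.mapIso (isoTriangleOfIso₁₂ _ _ (Bounded.ι.map_distinguished _ hT)
    (triangleOfSES_distinguished (S.shortExact_shortComplex K))
    ((projEquivalenceCounitIso B).app X)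
    (S.e.mapDerivedCategoryFactorsh.app ((S.l.mapHomotopyCategory (.up ℤ)).obj
      ((HomotopyCategory.quotient _ _).obj K))) ?_)
  have h : Bounded.ι.map ((derivedBoundedAdjunction S.adj hl).unit.app X) = _ :=
    (congr_arg Bounded.ι.map (NatTrans.congr_app (Adjunction.ofUniversalUnit_unit _ _) X)).trans
      (ι_map_derivedBoundedUnit_app S.adj hl X)
  have aux {X₁ X₂ X₃ X₄ : DerivedCategory B} (f : X₁ ⟶ X₂) (g : X₂ ⟶ X₃) (e : X₄ ≅ X₃) :
      (f ≫ g ≫ e.inv) ≫ e.hom = f ≫ g := by simp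
  exact (congr_arg (· ≫ _) h).trans (aux _ _ (S.e.mapDerivedCategoryFactorsh.app _))

omit [EnoughProjectives B] in
-- Truncating a projective resolution leaves a bounded complex with only its leftmost term possibly
-- non-projective. Dévissage in `B` shows that `e` of this term has finite projective dimension,
-- `hc` lifts this to `A`, and dévissage in `A` concludes.
lemma perfect_of_finiteProjDim_mapBounded_e [EnoughProjectives A]
    (hc : ∀ X : A, projectiveDimension (S.e.obj X) < ⊤ → projectiveDimension X < ⊤)
    (he : ∀ P : A, Projective P → projectiveDimension (S.e.obj P) < ⊤)
    (X : DerivedCategory.Bounded A) (hX : finiteProjDim B ((mapBounded S.e).obj X).obj) :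
    perfect A X := by
  obtain ⟨K, hK, ⟨x⟩⟩ := exists_isProjMinus_iso ((boundedToMinus A).obj X)
  obtain ⟨a, ha⟩ := exists_exact_of_isProjMinus_iso X x
  obtain ⟨b, _⟩ := hK.boundedAbove
  have : K.IsGE a := (K.isGE_iff a).2 ha
  let x' : X.obj ≅ Q.obj (K.truncGE a) := x ≪≫ asIso (Q.map (K.πTruncGE a))
  have hP (i : ℤ) (hi : a < i) : Projective ((K.truncGE a).X i) :=
    Projective.of_iso (K.truncGEXIso a i).symm (hK.projective i)
  have ha : projectiveDimension ((K.truncGE a).X a) < ⊤ := by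
    refine hc _ ((finiteProjDim_singleFunctor_iff _ a).1 (prop_singleFunctor_of_prop_Q_obj
      (finiteProjDim B) ((S.e.mapHomologicalComplex (.up ℤ)).obj (K.truncGE a)) a b ?_
      fun i hi => (finiteProjDim_singleFunctor_iff _ _).2 (he _ (hP i hi))))
    exact (finiteProjDim B).prop_of_iso (S.e.mapDerivedCategory.mapIso x' ≪≫
      S.e.mapDerivedCategoryFactors.app _) hX
  rw [perfect_iff_finiteProjDim]
  refine (finiteProjDim A).prop_of_iso x'.symm
    (prop_Q_obj_of_prop_singleFunctor _ _ a b fun i => ?_)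
  rw [finiteProjDim_singleFunctor_iff]
  obtain hi | rfl | hi := lt_trichotomy i a
  · rw [(projectiveDimension_eq_bot_iff _).2 ((K.truncGE a).isZero_of_isStrictlyGE a i)]
    exact bot_lt_top
  · exact ha
  · have := hP i hi
    exact (projectiveDimension_lt_top_iff_exists _).2 ⟨1, inferInstance⟩

lemma reflectsIsomorphisms_singFunctor_e [EnoughProjectives A]
    (h : PreservesPerfect (mapBounded S.e))
    (hc : ∀ X : A, projectiveDimension (S.e.obj X) < ⊤ → projectiveDimension X < ⊤)
    (he : ∀ P : A, Projective P → projectiveDimension (S.e.obj P) < ⊤) :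
    (singFunctor (mapBounded S.e) h).ReflectsIsomorphisms := by
  refine Functor.reflectsIsomorphisms_of_isZero _ fun X hX => ?_
  have : (Dsg.Q A).EssSurj := Localization.essSurj _ (perfect A).trW
  let x := (Dsg.Q A).objObjPreimageIso X
  refine IsZero.of_iso ?_ x.symm
  rw [isZero_Q_obj_iff]
  exact S.perfect_of_finiteProjDim_mapBounded_e hc he _
    ((isZero_singFunctor_obj_Q_iff _ h _).1 (hX.of_iso ((singFunctor _ h).mapIso x)))

end CleftExtension

theorem mainTheorem5
    {B : Type u₁} [Category.{v₁} B] [Abelian B] [EnoughProjectives B] [HasDerivedCategory.{w₁} B]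
    {A : Type u₂} [Category.{v₂} A] [Abelian A] [EnoughProjectives A] [HasDerivedCategory.{w₂} A]
    (S : CleftExtension B A)
    (ha : ∀ P : B, Projective P → projectiveDimension (S.F.obj P) < ⊤)
    (hb : ∃ N : ℕ, ∀ n : ℕ, N ≤ n → IsZero (S.F.leftDerived n))
    (hc : ∀ X : A, projectiveDimension (S.e.obj X) < ⊤ → projectiveDimension X < ⊤) :
    ∃ (he : SingularityCategory.PreservesPerfect (SingularityCategory.mapBounded S.e))
      (hF : SingularityCategory.PreservesBounded S.F)
      (hF' : SingularityCategory.PreservesPerfect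
        (SingularityCategory.leftDerivedBounded S.F hF)),
      SingularityCategory.IsTriangleEquivalence
          (SingularityCategory.singFunctor (SingularityCategory.mapBounded S.e) he) ↔
        IsZero (SingularityCategory.singFunctor
          (SingularityCategory.leftDerivedBounded S.F hF) hF') := by
  have hP := S.projectiveDimension_e_lt_top_of_projective ha
  have he := SingularityCategory.preservesPerfect_mapBounded S.e hP
  have hF := SingularityCategory.preservesBounded_of_isZero_leftDerived S.F hb
  refine ⟨he, hF, SingularityCategory.preservesPerfect_leftDerivedBounded S.F hF ha, ?_⟩
  have hl := S.preservesBounded_l hb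
  -- As a left adjoint of an exact functor, `l` sends projectives to projectives.
  have hl' := SingularityCategory.preservesPerfect_leftDerivedBounded S.l hl fun P hP => by
    have := S.adj.map_projective P hP
    exact (SingularityCategory.projectiveDimension_lt_top_iff_exists _).2 ⟨1, inferInstance⟩
  have := S.reflectsIsomorphisms_singFunctor_e he hc hP
  let adj := (SingularityCategory.derivedBoundedAdjunction S.adj hl).localization
    (SingularityCategory.Dsg.Q B) (SingularityCategory.perfect B).trW
    (SingularityCategory.Dsg.Q A) (SingularityCategory.perfect A).trW
    (SingularityCategory.singFunctor _ hl') (SingularityCategory.singFunctor _ he)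
  have hunit (X : DerivedCategory.Bounded B) :
      IsIso (adj.unit.app ((SingularityCategory.Dsg.Q B).obj X)) ↔
        SingularityCategory.finiteProjDim B
          ((SingularityCategory.leftDerivedBounded S.F hF).obj X).obj := by
    rw [← S.isIso_Q_map_unit_iff hl hF, Adjunction.localization_unit_app]
    exact isIso_comp_right_iff _ _
  rw [SingularityCategory.isZero_singFunctor_iff]
  simp only [← hunit]
  -- The functor induced by `e` is always triangulated, so only being an equivalence is at stake.
  refine Iff.trans ⟨fun h => h.2, fun h => ⟨inferInstance, h⟩⟩
    (adj.isEquivalence_right_iff_isIso_unit.trans ⟨fun _ X => inferInstance, fun H => ?_⟩)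
  -- The unit is known to be invertible only on images of the quotient functor, which reach every
  -- object up to isomorphism.
  have : (SingularityCategory.Dsg.Q B).EssSurj :=
    Localization.essSurj _ (SingularityCategory.perfect B).trW
  have (X : SingularityCategory.Dsg B) : IsIso (adj.unit.app X) :=
    (NatTrans.isIso_app_iff_of_iso adj.unit
      ((SingularityCategory.Dsg.Q B).objObjPreimageIso X)).1 (H _)
  exact NatIso.isIso_of_isIso_app _
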